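/- **Setting.** Fix integers $p,K,T$ and consider the dynamic panel model $$y_{it}=\sum_{j=1}^{p}\delta_{0j}\,y_{i,t-j}+\boldsymbol x_{it}'\boldsymbol\beta_0+e_{it}\qquad(t=1,\dots,T,\ i=1,2,\dots),$$ with observed $y_{i,1-p},\dots,y_{iT}$ and $\boldsymbol x_{it}=(x_{it1},\dots,x_{itK})'$. Let $\boldsymbol y_i=(y_{i1},\dots,y_{iT})'$, let $\boldsymbol x_i$ be the vector of the distinct elements of $\boldsymbol x_{i1},\dots,\boldsymbol x_{iT}$, $\boldsymbol y_i^o=(y_{i0},\dots,y_{i,1-p})'$ and $\boldsymbol z_i=(\boldsymbol x_i',\boldsymbol y_i^{o\prime})'$. Let $\boldsymbol\theta_0=\mathrm{Var}(\boldsymbol z_i)^{-1}\mathrm{Cov}(\boldsymbol z_i,e_{it})$ and $\mu_0=E(e_{it})-E(\boldsymbol z_i)'\boldsymbol\theta_0$ be the coefficients of the linear projection of $e_{it}$ on $1$ and $\boldsymbol z_i$ (they depend on neither $i$ nor $t$ under C2 below), let $u_{it}=e_{it}-\mu_0-\boldsymbol z_i'\boldsymbol\theta_0$ and $\boldsymbol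 u_i=(u_{i1},\dots,u_{iT})'$. Let $\boldsymbol W_i$ be the matrix whose row $t$ is $(y_{i,t-1},\dots,y_{i,t-p},\boldsymbol x_{it}',1,\boldsymbol z_i')$. For $\boldsymbol\gamma=(\boldsymbol\delta',\boldsymbol\beta',\mu,\boldsymbol\theta')'$ and $\boldsymbol\omega=\mathrm{vech}(\Omega)$, $\Omega$ a symmetric $T\times T$ matrix, put $\boldsymbol\psi=(\boldsymbol\gamma',\boldsymbol\omega')'$, let $\Psi$ be the set of all $\boldsymbol\psi$ for which $\Omega$ is positive definite, and for $\boldsymbol\psi\in\Psi$ put $$l_i(\boldsymbol\psi)=-\tfrac T2\ln(2\pi)-\tfrac12\ln|\Omega|-\tfrac12(\boldsymbol y_i-\boldsymbol W_i\boldsymbol\gamma)'\Omega^{-1}(\boldsymbol y_i-\boldsymbol W_i\boldsymbol\gamma),\qquad L_N(\boldsymbol\psi)=N^{-1}\sum_{i=1}^N l_i(\boldsymbol\psi),$$ and $\boldsymbol H_N(\boldsymbol\psi)=\partial^2L_N(\boldsymbol\psi)/\partial\boldsymbol\psi\,\partial\boldsymbol\psi'$. **Theorem.** Assume: * **C1:**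 for some $\epsilon>0$ and $M<\infty$, $E|y_{it}|^{2+\epsilon}<M$ and $E|x_{itk}|^{2+\epsilon}<M$ for all $i,t,k$ (for $y_{it}$, all $t=1-p,\dots,T$); * **C2:** there are a positive definite matrix $\Xi_{zz}$, vectors $\boldsymbol\mu_z,\boldsymbol\varrho_{ze}$ and a number $\mu_e$ with $\mathrm{Var}(\boldsymbol z_i)=\Xi_{zz}$ and $E(\boldsymbol z_i)=\boldsymbol\mu_z$ for all $i$, and $E(e_{it})=\mu_e$ and $E(\boldsymbol z_ie_{it})=\boldsymbol\varrho_{ze}$ for all $i$ and $t\ge1$; * **C3:** $E(\boldsymbol u_i\boldsymbol u_i')=\Omega_0$ for all $i$, with $\Omega_0$ positive definite; * **C4:** the limits as $N\to\infty$ of $N^{-1}\sum_{i\le N}E(y_{is}y_{it})$, $N^{-1}\sum_{i\le N}E(y_{is}x_{itk})$ and $N^{-1}\sum_{i\le N}E(x_{isj}x_{itk})$ exist for all $s,t,j,k$ (for the $y$'s, all dates $1-p,\dots,T$); * **C5:** the vectors $(\boldsymbol z_1',\boldsymbol y_1')',\dots,(\boldsymbol z_N',\boldsymbol y_N')'$ are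 independent for all $N$. Let $\boldsymbol\gamma_0=(\boldsymbol\delta_0',\boldsymbol\beta_0',\mu_0,\boldsymbol\theta_0')'$ and $\boldsymbol\psi_0=(\boldsymbol\gamma_0',\mathrm{vech}(\Omega_0)')'$. Then $L_N$ is twice continuously differentiable on $\Psi$, $E[\partial L_N(\boldsymbol\psi_0)/\partial\boldsymbol\psi]=\boldsymbol 0$ for every $N$, and for every $\boldsymbol\psi\in\Psi$ the limit $\boldsymbol H(\boldsymbol\psi)=\lim_{N\to\infty}E[\boldsymbol H_N(\boldsymbol\psi)]$ exists (all these expectations being finite). Moreover, if $\boldsymbol H_0=\boldsymbol H(\boldsymbol\psi_0)$ is negative definite, then there are a compact set $\overline\Psi\subset\Psi$ with $\boldsymbol\psi_0$ in its interior and, for each $N$, a measurable function $\widehat{\boldsymbol\psi}_N$ of the first $N$ observations that maximizes $L_N$ over $\overline\Psi$, such that $\widehat{\boldsymbol\psi}_N\to\boldsymbol\psi_0$ almost surely as $N\to\infty$ with $T$ fixed. -/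

import Mathlib

open MeasureTheory ProbabilityTheory Filter Topology
open scoped ENNReal NNReal Matrix

noncomputable section

namespace LevelsQML

/-- The observation on one individual: the vector `x` of the `q` distinct elements of the
regressors `x_1, …, x_T`, and the path `(y_{1-p}, …, y_0, y_1, …, y_T)` of the dependent variable;
position `r : Fin (p + T)` of the path is date `r - p + 1`.
Up to the order of the coordinates this is the vector `(z', y')'`. -/
abbrev Obs (q p T : ℕ) : Type := (Fin q → ℝ) × (Fin (p + T) → ℝ)

/-- Index set of `γ = (δ', β', μ, θ')'`; the coordinates of `θ` are those of `z = (x', y^o')'`. -/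
abbrev GammaIdx (q p K : ℕ) : Type := (Fin p ⊕ Fin K) ⊕ (Unit ⊕ (Fin q ⊕ Fin p))

/-- Index set of `vech Ω` for a `T × T` matrix: the positions on and below the diagonal. -/
abbrev VechIdx (T : ℕ) : Type := {st : Fin T × Fin T // st.2 ≤ st.1}

/-- Index set of `ψ = (γ', ω')'`. -/
abbrev PsiIdx (q p K T : ℕ) : Type := GammaIdx q p K ⊕ VechIdx T

section Vech

variable {T : ℕ}

/-- Half-vectorization. -/
def vech (A : Matrix (Fin T) (Fin T) ℝ) : VechIdx T → ℝ := fun st => A st.1.1 st.1.2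

/-- The symmetric matrix `Ω` with `vech Ω = ω`. -/
def ofVech (ω : VechIdx T → ℝ) : Matrix (Fin T) (Fin T) ℝ :=
  Matrix.of fun s t =>
    if h : t ≤ s then ω ⟨(s, t), h⟩ else ω ⟨(t, s), le_of_not_ge h⟩

theorem vech_ofVech (ω : VechIdx T → ℝ) : vech (ofVech ω) = ω := by
  funext st
  obtain ⟨⟨s, t⟩, h⟩ := st
  have h' : t ≤ s := h
  simp [vech, ofVech, h']

theorem ofVech_vech {A : Matrix (Fin T) (Fin T) ℝ} (hA : A.IsSymm) : ofVech (vech A) = A := by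
  ext s t
  by_cases h : t ≤ s
  · simp [vech, ofVech, h]
  · simp [vech, ofVech, h, hA.apply s t]

end Vech

section Model

variable {q p K T : ℕ}

/-- `y_t`, for `t = 1, …, T` (`t : Fin T` stands for date `t + 1`). -/
def yCur (o : Obs q p T) (t : Fin T) : ℝ := o.2 (Fin.natAdd p t)

/-- The lag `y_{t-j}`, for `j = 1, …, p` (`j : Fin p` stands for lag `j + 1`). -/
def yLag (o : Obs q p T) (t : Fin T) (j : Fin p) : ℝ :=
  o.2 ⟨p + t.val - (j.val + 1), by omega⟩

/-- The `k`-th regressor `x_{tk}` at date `t`. The map `κ` says which distinct element it is. -/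
def xReg (κ : Fin T → Fin K → Fin q) (o : Obs q p T) (t : Fin T) (k : Fin K) : ℝ := o.1 (κ t k)

/-- `z = (x', y^o')'` with `y^o = (y_0, y_{-1}, …, y_{1-p})'`. -/
def zVec (o : Obs q p T) : Fin q ⊕ Fin p → ℝ :=
  Sum.elim o.1 fun j => o.2 (Fin.castAdd T j.rev)

/-- The model error `e_t = y_t - ∑_j δ_j y_{t-j} - x_t' β`. -/
def modelErr (κ : Fin T → Fin K → Fin q) (δ : Fin p → ℝ) (β : Fin K → ℝ)
    (o : Obs q p T) (t : Fin T) : ℝ :=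
  yCur o t - ∑ j, δ j * yLag o t j - ∑ k, β k * xReg κ o t k

/-- The slope `θ₀ = Var(z)⁻¹ Cov(z, e_t)` of the linear projection of `e_t` on `1` and `z`, where
`Ξ = Var(z)`, `μz = E z`, `μe = E e_t`, `ϱ = E (z e_t)`. -/
def theta0 (Ξ : Matrix (Fin q ⊕ Fin p) (Fin q ⊕ Fin p) ℝ) (μz : Fin q ⊕ Fin p → ℝ) (μe : ℝ)
    (ϱ : Fin q ⊕ Fin p → ℝ) : Fin q ⊕ Fin p → ℝ :=
  Ξ⁻¹ *ᵥ (ϱ - μe • μz)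

/-- The intercept `μ₀ = E e_t - (E z)' θ₀` of the linear projection. -/
def mu0 (Ξ : Matrix (Fin q ⊕ Fin p) (Fin q ⊕ Fin p) ℝ) (μz : Fin q ⊕ Fin p → ℝ) (μe : ℝ)
    (ϱ : Fin q ⊕ Fin p → ℝ) : ℝ :=
  μe - μz ⬝ᵥ theta0 Ξ μz μe ϱ

/-- `γ = (δ', β', μ, θ')'`. -/
def mkGamma (δ : Fin p → ℝ) (β : Fin K → ℝ) (μ : ℝ) (θ : Fin q ⊕ Fin p → ℝ) :
    GammaIdx q p K → ℝ :=
  Sum.elim (Sum.elim δ β) (Sum.elim (fun _ => μ) θ)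

/-- `ψ = (γ', vech(Ω)')'`. -/
def mkPsi (γ : GammaIdx q p K → ℝ) (Ω : Matrix (Fin T) (Fin T) ℝ) : PsiIdx q p K T → ℝ :=
  Sum.elim γ (vech Ω)

/-- The projection error `u_t = e_t - μ - z' θ`. -/
def projErr (κ : Fin T → Fin K → Fin q) (δ : Fin p → ℝ) (β : Fin K → ℝ) (μ : ℝ)
    (θ : Fin q ⊕ Fin p → ℝ) (o : Obs q p T) (t : Fin T) : ℝ :=
  modelErr κ δ β o t - μ - zVec o ⬝ᵥ θ

/-- The regressor matrix `W = (Y, X, ι, ι z')` of the augmented model. -/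
def wMat (κ : Fin T → Fin K → Fin q) (o : Obs q p T) : Matrix (Fin T) (GammaIdx q p K) ℝ :=
  Matrix.of fun t => Sum.elim (Sum.elim (yLag o t) (xReg κ o t)) (Sum.elim (fun _ => 1) (zVec o))

/-- `u(γ) = y - W γ`. -/
def resid (κ : Fin T → Fin K → Fin q) (o : Obs q p T) (γ : GammaIdx q p K → ℝ) : Fin T → ℝ :=
  yCur o - wMat κ o *ᵥ γ

/-- The `γ` part of `ψ`. -/
def gammaOf (ψ : PsiIdx q p K T → ℝ) : GammaIdx q p K → ℝ := fun a => ψ (Sum.inl a)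

/-- The matrix `Ω` encoded by the `ω` part of `ψ`. -/
def omegaOf (ψ : PsiIdx q p K T → ℝ) : Matrix (Fin T) (Fin T) ℝ :=
  ofVech fun a => ψ (Sum.inr a)

/-- The parameter space `Ψ`. -/
def paramSpace (q p K T : ℕ) : Set (PsiIdx q p K T → ℝ) := {ψ | (omegaOf ψ).PosDef}

/-- The quasi log-likelihood `l(ψ)` of one observation. -/
def logLik (κ : Fin T → Fin K → Fin q) (o : Obs q p T) (ψ : PsiIdx q p K T → ℝ) : ℝ :=
  -((T : ℝ) / 2) * Real.log (2 * Real.pi) - 1 / 2 * Real.log (omegaOf ψ).det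
    - 1 / 2 * (resid κ o (gammaOf ψ) ⬝ᵥ ((omegaOf ψ)⁻¹ *ᵥ resid κ o (gammaOf ψ)))

/-- The average quasi log-likelihood `L_N(ψ)` of a sample of size `N`. -/
def avgLogLik (κ : Fin T → Fin K → Fin q) {N : ℕ} (w : Fin N → Obs q p T)
    (ψ : PsiIdx q p K T → ℝ) : ℝ :=
  (N : ℝ)⁻¹ * ∑ i, logLik κ (w i) ψ

end Model

section Derivatives

variable {ι : Type*} [Fintype ι] [DecidableEq ι]

/-- The partial derivative `∂f/∂ψ_a`. -/
def partialDeriv (f : (ι → ℝ) → ℝ) (a : ι) (ψ : ι → ℝ) : ℝ := fderiv ℝ f ψ (Pi.single a 1)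

/-- The Hessian matrix `∂²f/∂ψ∂ψ'`. -/
def hessianMat (f : (ι → ℝ) → ℝ) (ψ : ι → ℝ) : Matrix ι ι ℝ :=
  Matrix.of fun a b => partialDeriv (partialDeriv f b) a ψ

end Derivatives

section Conditions

variable {q p K T : ℕ} {S : Type*} [MeasurableSpace S]

/-- The sample formed by the first `N` individuals. -/
def sample (D : ℕ → S → Obs q p T) (N : ℕ) (s : S) : Fin N → Obs q p T := fun i => D i s

/-- `N⁻¹ ∑_{i ≤ N} a_i` converges to a real limit. -/
def AvgConverges (a : ℕ → ℝ) : Prop :=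
  ∃ l : ℝ, Tendsto (fun N : ℕ => (N : ℝ)⁻¹ * ∑ i ∈ Finset.range N, a i) atTop (𝓝 l)

/-- C1: uniformly bounded moments of order `2 + ε`. -/
def CondC1 (κ : Fin T → Fin K → Fin q) (P : Measure S) (D : ℕ → S → Obs q p T) : Prop :=
  ∃ ε : ℝ, 0 < ε ∧ ∃ M : ℝ≥0,
    (∀ i r, ∫⁻ s, ‖(D i s).2 r‖ₑ ^ (2 + ε) ∂P < M) ∧
    (∀ i t k, ∫⁻ s, ‖xReg κ (D i s) t k‖ₑ ^ (2 + ε) ∂P < M)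

/-- C2: `Var(z_i) = Ξ` is positive definite and `E z_i = μz`, `E e_{it} = μe`,
`E (z_i e_{it}) = ϱ` for all `i` and all `t ≥ 1`. -/
def CondC2 (κ : Fin T → Fin K → Fin q) (P : Measure S) (D : ℕ → S → Obs q p T)
    (δ : Fin p → ℝ) (β : Fin K → ℝ) (Ξ : Matrix (Fin q ⊕ Fin p) (Fin q ⊕ Fin p) ℝ)
    (μz : Fin q ⊕ Fin p → ℝ) (μe : ℝ) (ϱ : Fin q ⊕ Fin p → ℝ) : Prop :=
  Ξ.PosDef ∧
  (∀ i a b, cov[fun s => zVec (D i s) a, fun s => zVec (D i s) b; P] = Ξ a b) ∧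
  (∀ i a, ∫ s, zVec (D i s) a ∂P = μz a) ∧
  (∀ i t, ∫ s, modelErr κ δ β (D i s) t ∂P = μe) ∧
  (∀ i t a, ∫ s, zVec (D i s) a * modelErr κ δ β (D i s) t ∂P = ϱ a)

/-- C3: `E (u_i u_i') = Ω₀` for all `i`, and `Ω₀` is positive definite. -/
def CondC3 (κ : Fin T → Fin K → Fin q) (P : Measure S) (D : ℕ → S → Obs q p T)
    (δ : Fin p → ℝ) (β : Fin K → ℝ) (μ : ℝ) (θ : Fin q ⊕ Fin p → ℝ)
    (Ω₀ : Matrix (Fin T) (Fin T) ℝ) : Prop :=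
  Ω₀.PosDef ∧
  ∀ i s t, ∫ v, projErr κ δ β μ θ (D i v) s * projErr κ δ β μ θ (D i v) t ∂P = Ω₀ s t

/-- C4: the averages of the second-order cross moments of the `y`s and `x`s converge. -/
def CondC4 (κ : Fin T → Fin K → Fin q) (P : Measure S) (D : ℕ → S → Obs q p T) : Prop :=
  (∀ r r', AvgConverges fun i => ∫ v, (D i v).2 r * (D i v).2 r' ∂P) ∧
  (∀ r t k, AvgConverges fun i => ∫ v, (D i v).2 r * xReg κ (D i v) t k ∂P) ∧
  (∀ s j t k, AvgConverges fun i => ∫ v, xReg κ (D i v) s j * xReg κ (D i v) t k ∂P)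

end Conditions

end LevelsQML

end

open LevelsQML

/-!
The quasi log-likelihood of one observation is linear in finitely many statistics: the constant `1`
and the products of two variables of the augmented regression (`augMoment`). Hence
`L_N(ψ) = ∑ j, momCoef j ψ * m_N j` with `m_N` the sample averages of these statistics
(`avgLogLik_eq_critFn`), and the coefficients `momCoef j` are smooth on `Ψ`. Differentiability,
integrability of the score and of the Hessian, and interchange of expectation and differentiation
are therefore finite sums. Condition C4 gives the limits `m` of the expected averages of products;
C2 makes the first moments independent of `i`, those of `y_1, …, y_T` by recursion on the date
(`exists_integral_coord_eq`). The limit of the expected Hessian is the Hessian of the limiting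
criterion `critFn m`.

The expected score at `ψ₀` vanishes (`integral_partialDeriv_logLik_eq_zero`). For the elements of
`Ω` this is Jacobi's formula together with `E (u u') = Ω₀`. For the coefficients put
`η = Ω₀⁻¹ u`. It satisfies `E (z η') = 0`, by the normal equations of the projection, and
`E (u η')` is the identity, so that by recursion on the date `η_t` is uncorrelated with every `y`
dated before `t`, in particular with the lags in row `t` of `W`.

For consistency, a zero gradient and a negative definite Hessian make `ψ₀` the unique maximizer of
`critFn m` over a small closed ball (`eventually_lt_of_hessian_negDef`). A strong law for
independent variables with bounded moments of some order above `1` (`ae_tendsto_average_centred`)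
gives `m_N → m` almost surely. As the criterion is jointly continuous on the ball times the space of
moments, a maximizer can be selected measurably (`exists_measurable_isMaxOn`), and every cluster
point of the maximizers is `ψ₀` (`tendsto_of_isMaxOn_of_unique`).
-/

/-! ### Laws of large numbers for independent random variables -/

/-- **Kronecker's lemma** with weights `1 / (i + 1)`. -/
theorem tendsto_average_zero_of_tendsto_sum_div {x : ℕ → ℝ} {c : ℝ}
    (h : Tendsto (fun n => ∑ i ∈ Finset.range n, x i / (i + 1)) atTop (𝓝 c)) :
    Tendsto (fun n : ℕ => (n : ℝ)⁻¹ * ∑ i ∈ Finset.range n, x i) atTop (𝓝 0) := by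
  set A : ℕ → ℝ := fun n => ∑ i ∈ Finset.range n, x i / (i + 1) with hA
  -- summation by parts
  have key : ∀ n : ℕ, ∑ i ∈ Finset.range n, x i = n * A n - ∑ i ∈ Finset.range n, A i := by
    intro n
    induction n with
    | zero => simp
    | succ n ih =>
      have h1 : A (n + 1) = A n + x n / (n + 1) := by simp [hA, Finset.sum_range_succ]
      have h2 : ((n : ℝ) + 1) ≠ 0 := by positivity
      rw [Finset.sum_range_succ, Finset.sum_range_succ, ih, h1]
      push_cast
      field_simp
      ring
  have h3 := h.sub h.cesaro
  rw [sub_self] at h3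
  refine h3.congr' ?_
  filter_upwards [eventually_gt_atTop 0] with n hn
  have : (n : ℝ) ≠ 0 := by positivity
  rw [key, mul_sub, inv_mul_cancel_left₀ this]

/-- A series of centred independent random variables converges almost surely when the absolute
moments of some order `p ∈ [1, 2]` are summable. The partial sums form a martingale; truncating the
terms at `1` bounds it in `L¹`, by variances for the truncated parts and by first moments for the
remainders. -/
theorem ae_tendsto_sum_centred {Ω : Type*} [MeasurableSpace Ω] {P : Measure Ω}
    [IsProbabilityMeasure P] {ξ : ℕ → Ω → ℝ} (hm : ∀ i, Measurable (ξ i)) (hi : iIndepFun ξ P)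
    {p : ℝ} (hp1 : 1 ≤ p) (hp2 : p ≤ 2) (hint : ∀ i, Integrable (fun ω => |ξ i ω| ^ p) P)
    (hsum : Summable fun i => ∫ ω, |ξ i ω| ^ p ∂P) :
    ∀ᵐ ω ∂P, ∃ c, Tendsto (fun n => ∑ i ∈ Finset.range n, (ξ i ω - ∫ v, ξ i v ∂P)) atTop (𝓝 c) := by
  classical
  set b : ℕ → ℝ := fun i => ∫ ω, |ξ i ω| ^ p ∂P with hb
  have hb0 : ∀ i, 0 ≤ b i := fun i => integral_nonneg fun ω => by positivity
  let f : ℝ → ℝ := fun x => if |x| ≤ 1 then x else 0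
  let g : ℝ → ℝ := fun x => if |x| ≤ 1 then 0 else x
  have hset : MeasurableSet {x : ℝ | |x| ≤ 1} := measurableSet_le (by fun_prop) measurable_const
  have hfm : Measurable f := Measurable.ite hset measurable_id measurable_const
  have hgm : Measurable g := Measurable.ite hset measurable_const measurable_id
  have hfg : ∀ x, x = f x + g x := fun x => by simp only [f, g]; split_ifs <;> simp
  have hf1 : ∀ x, |f x| ≤ 1 := fun x => by
    simp only [f]; split_ifs with h
    · exact h
    · simp
  have hf2 : ∀ x, f x ^ 2 ≤ |x| ^ p := fun x => by
    simp only [f]; split_ifs with h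
    · rw [← sq_abs, ← Real.rpow_natCast]
      rcases (abs_nonneg x).eq_or_lt with h0 | h0
      · rw [← h0, Real.zero_rpow (by norm_num), Real.zero_rpow (by linarith)]
      · exact Real.rpow_le_rpow_of_exponent_ge h0 h (by exact_mod_cast hp2)
    · simp only [ne_eq, OfNat.ofNat_ne_zero, not_false_eq_true, zero_pow]; positivity
  have hg1 : ∀ x, |g x| ≤ |x| ^ p := fun x => by
    simp only [g]; split_ifs with h
    · simp only [abs_zero]; positivity
    · exact Real.self_le_rpow_of_one_le (not_le.1 h).le hp1
  have hfi : ∀ i, MemLp (fun ω => f (ξ i ω)) 2 P := fun i =>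
    MemLp.of_bound (hfm.comp (hm i)).aestronglyMeasurable 1
      (Eventually.of_forall fun ω => by simpa using hf1 (ξ i ω))
  have hfI : ∀ i, Integrable (fun ω => f (ξ i ω)) P := fun i => (hfi i).integrable (by norm_num)
  have hgI : ∀ i, Integrable (fun ω => g (ξ i ω)) P := fun i =>
    (hint i).mono' (hgm.comp (hm i)).aestronglyMeasurable
      (Eventually.of_forall fun ω => by simpa using hg1 (ξ i ω))
  have hξI : ∀ i, Integrable (ξ i) P := fun i => by
    refine ((hfI i).add (hgI i)).congr (Eventually.of_forall fun ω => ?_)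
    simp [← hfg]
  have hEξ : ∀ i, ∫ ω, ξ i ω ∂P = ∫ ω, f (ξ i ω) ∂P + ∫ ω, g (ξ i ω) ∂P := fun i => by
    rw [← integral_add (hfI i) (hgI i)]
    exact integral_congr_ae (Eventually.of_forall fun ω => hfg _)
  set S : ℕ → Ω → ℝ := fun n ω => ∑ i ∈ Finset.range (n + 1), (ξ i ω - ∫ v, ξ i v ∂P) with hS
  have hSI : ∀ n, Integrable (S n) P := fun n =>
    integrable_finsetSum _ fun i _ => (hξI i).sub (integrable_const _)
  let ℱ := Filtration.natural ξ fun i => (hm i).stronglyMeasurable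
  have hadap : ∀ i n, i ≤ n → StronglyMeasurable[ℱ n] (ξ i) := fun i n hin =>
    (Filtration.stronglyAdapted_natural (fun i => (hm i).stronglyMeasurable) i).mono (ℱ.mono hin)
  have hSm : ∀ n, StronglyMeasurable[ℱ n] (S n) := fun n =>
    Finset.stronglyMeasurable_fun_sum _ fun i hi' =>
      (hadap i n (by simpa [Nat.lt_succ_iff] using hi')).sub stronglyMeasurable_const
  have hmart : Martingale S ℱ P := by
    refine martingale_nat (fun n => hSm n) hSI fun n => ?_
    have hdec : S (n + 1) = S n + fun ω => (ξ (n + 1) ω - ∫ v, ξ (n + 1) v ∂P) := by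
      funext ω; simp [hS, Finset.sum_range_succ _ (n + 1)]; ring
    have h1 := iIndepFun.condExp_natural_ae_eq_of_lt (fun i => (hm i).stronglyMeasurable) hi
      (Nat.lt_succ_self n)
    have h2 : P[S (n + 1) | ℱ n] =ᵐ[P]
        P[S n | ℱ n] + P[fun ω => (ξ (n + 1) ω - ∫ v, ξ (n + 1) v ∂P) | ℱ n] := by
      rw [hdec]
      exact condExp_add (hSI n) ((hξI _).sub (integrable_const _)) _
    have h3 : P[fun ω => (ξ (n + 1) ω - ∫ v, ξ (n + 1) v ∂P) | ℱ n] =ᵐ[P]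
        P[ξ (n + 1) | ℱ n] - P[fun _ => ∫ v, ξ (n + 1) v ∂P | ℱ n] :=
      condExp_sub (hξI (n + 1)) (integrable_const _) _
    rw [condExp_const (ℱ.le n)] at h3
    rw [condExp_of_stronglyMeasurable (ℱ.le n) (hSm n) (hSI n)] at h2
    filter_upwards [h1, h2, h3] with ω e1 e2 e3
    rw [e2, Pi.add_apply, e3, Pi.sub_apply, e1]
    simp
  -- the `L¹` bound
  have hbd : ∀ n, ∫ ω, |S n ω| ∂P ≤ 1 + 3 * ∑' i, b i := fun n => by
    let s := Finset.range (n + 1)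
    let F : Ω → ℝ := ∑ i ∈ s, fun ω => f (ξ i ω)
    have hFL : MemLp F 2 P := memLp_finsetSum' _ fun i _ => hfi i
    have hvar : Var[F; P] ≤ ∑ i ∈ s, b i := by
      rw [IndepFun.variance_sum (fun i _ => hfi i) fun i _ j _ hij =>
        (hi.indepFun hij).comp hfm hfm]
      refine Finset.sum_le_sum fun i _ => ?_
      refine (variance_le_expectation_sq (hfm.comp (hm i)).aestronglyMeasurable).trans ?_
      exact integral_mono (hfi i).integrable_sq (hint i) fun ω => hf2 _
    have hEF : ∫ ω, F ω ∂P = ∑ i ∈ s, ∫ ω, f (ξ i ω) ∂P := by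
      simp only [F, Finset.sum_apply]
      exact integral_finsetSum _ fun i _ => hfI i
    have hVI : Integrable (fun ω => (F ω - ∫ v, F v ∂P) ^ 2) P :=
      (hFL.sub (memLp_const _)).integrable_sq
    have hGI : Integrable (fun ω => ∑ i ∈ s, |g (ξ i ω)|) P :=
      integrable_finsetSum _ fun i _ => (hgI i).abs
    have hpt : ∀ ω, |S n ω| ≤ (1 + (F ω - ∫ v, F v ∂P) ^ 2) +
        (∑ i ∈ s, |g (ξ i ω)| + ∑ i ∈ s, ∫ v, |g (ξ i v)| ∂P) := fun ω => by
      have e : S n ω = (F ω - ∫ v, F v ∂P) +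
          (∑ i ∈ s, g (ξ i ω) - ∑ i ∈ s, ∫ v, g (ξ i v) ∂P) := by
        rw [hEF]
        simp only [hS, F, Finset.sum_apply, ← Finset.sum_sub_distrib, ← Finset.sum_add_distrib]
        refine Finset.sum_congr rfl fun i _ => ?_
        rw [hEξ]
        nth_rewrite 1 [hfg (ξ i ω)]
        ring
      rw [e]
      refine (abs_add_le _ _).trans (add_le_add ?_ ((abs_sub _ _).trans (add_le_add ?_ ?_)))
      · set u := F ω - ∫ v, F v ∂P
        nlinarith [sq_nonneg (|u| - 1), sq_abs u, abs_nonneg u]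
      · exact Finset.abs_sum_le_sum_abs _ _
      · exact (Finset.abs_sum_le_sum_abs _ _).trans
          (Finset.sum_le_sum fun i _ => abs_integral_le_integral_abs)
    have hgb : ∑ i ∈ s, ∫ v, |g (ξ i v)| ∂P ≤ ∑ i ∈ s, b i :=
      Finset.sum_le_sum fun i _ => integral_mono (hgI i).abs (hint i) fun ω => hg1 _
    have hsb : ∑ i ∈ s, b i ≤ ∑' i, b i := hsum.sum_le_tsum _ fun i _ => hb0 i
    have h4 := integral_mono (hSI n).abs
      (((integrable_const (1 : ℝ)).add hVI).add (hGI.add (integrable_const _))) hpt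
    rw [integral_add' ((integrable_const (1 : ℝ)).add hVI) (hGI.add (integrable_const _)),
      integral_add' (integrable_const _) hVI, integral_add' hGI (integrable_const _),
      integral_finsetSum _ fun i _ => (hgI i).abs,
      ← variance_eq_integral hFL.aestronglyMeasurable.aemeasurable] at h4
    simp only [integral_const, probReal_univ, smul_eq_mul, one_mul] at h4
    linarith
  have hbd' : ∀ n, eLpNorm (S n) 1 P ≤ ((1 + 3 * ∑' i, b i).toNNReal : ℝ≥0∞) := fun n => by
    rw [eLpNorm_one_eq_lintegral_enorm, ← ofReal_integral_norm_eq_lintegral_enorm (hSI n)]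
    exact ENNReal.ofReal_le_ofReal (hbd n)
  filter_upwards [hmart.submartingale.exists_ae_tendsto_of_bdd hbd'] with ω ⟨c, hc⟩
  exact ⟨c, (tendsto_add_atTop_iff_nat 1).1 hc⟩

/-- A strong law of large numbers for independent, not necessarily identically distributed random
variables with bounded absolute moments of an order `p > 1`. -/
theorem ae_tendsto_average_centred {Ω : Type*} [MeasurableSpace Ω] {P : Measure Ω}
    [IsProbabilityMeasure P] {X : ℕ → Ω → ℝ} (hm : ∀ i, Measurable (X i)) (hi : iIndepFun X P)
    {p : ℝ} (hp1 : 1 < p) (hp2 : p ≤ 2) (hint : ∀ i, Integrable (fun ω => |X i ω| ^ p) P)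
    {M : ℝ} (hM : ∀ i, ∫ ω, |X i ω| ^ p ∂P ≤ M) :
    ∀ᵐ ω ∂P, Tendsto (fun n : ℕ => (n : ℝ)⁻¹ * ∑ i ∈ Finset.range n, (X i ω - ∫ v, X i v ∂P))
      atTop (𝓝 0) := by
  have hpow : ∀ i ω, |X i ω / ((i : ℝ) + 1)| ^ p = |X i ω| ^ p * (((i : ℝ) + 1) ^ p)⁻¹ := by
    intro i ω
    have : (0 : ℝ) ≤ (i : ℝ) + 1 := by positivity
    rw [abs_div, abs_of_nonneg this, Real.div_rpow (abs_nonneg _) this, div_eq_mul_inv]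
  have hsum : Summable fun i : ℕ => M * (((i : ℝ) + 1) ^ p)⁻¹ := by
    have := (summable_nat_add_iff 1).2 (Real.summable_nat_rpow_inv.2 hp1)
    exact (by simpa using this : Summable fun i : ℕ => (((i : ℝ) + 1) ^ p)⁻¹).mul_left M
  have key := ae_tendsto_sum_centred (P := P) (ξ := fun i ω => X i ω / ((i : ℝ) + 1))
    (fun i => (hm i).div_const _)
    (hi.comp (fun i x => x / ((i : ℝ) + 1)) fun i => measurable_id.div_const _) hp1.le hp2
    (fun i => by simpa only [hpow] using (hint i).mul_const _)
    (by
      refine hsum.of_nonneg_of_le (fun i => integral_nonneg fun ω => by positivity) fun i => ?_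
      simp only [hpow, integral_mul_const]
      exact mul_le_mul_of_nonneg_right (hM i) (by positivity))
  filter_upwards [key] with ω ⟨c, hc⟩
  refine tendsto_average_zero_of_tendsto_sum_div (c := c) ?_
  refine hc.congr fun n => Finset.sum_congr rfl fun i _ => ?_
  rw [integral_div, sub_div]

/-! ### Maximizers of continuous criteria -/

/-- **Measurable maximum theorem.** A jointly continuous criterion on a compact metric space has a
maximizer that depends measurably on the data. With a continuous surjection from the Cantor set,
a compact subset of the line, the smallest maximizer can be selected, and its sublevel sets are
projections of closed sets along a compact factor. -/
theorem exists_measurable_isMaxOn {X E : Type*} [MetricSpace X] [CompactSpace X] [Nonempty X]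
    [MeasurableSpace X] [BorelSpace X] [TopologicalSpace E] [MeasurableSpace E]
    [OpensMeasurableSpace E] {F : X × E → ℝ} (hF : Continuous F) :
    ∃ f : E → X, Measurable f ∧ ∀ e x, F (x, e) ≤ F (f e, e) := by
  obtain ⟨φ₀, hφ₀, hs₀⟩ := exists_nat_bool_continuous_surjective_of_compact X
  let φ : cantorSet → X := φ₀ ∘ cantorSetHomeomorphNatToBool
  have hφ : Continuous φ := hφ₀.comp cantorSetHomeomorphNatToBool.continuous
  have hs : Function.Surjective φ := hs₀.comp cantorSetHomeomorphNatToBool.surjective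
  have : CompactSpace cantorSet := isCompact_iff_compactSpace.1 isCompact_cantorSet
  have : Nonempty cantorSet := ⟨(hs (Classical.arbitrary X)).choose⟩
  let A : Set (cantorSet × E) := {z | ∀ x, F (x, z.2) ≤ F (φ z.1, z.2)}
  have hA : IsClosed A := by
    have : A = ⋂ x, {z | F (x, z.2) ≤ F (φ z.1, z.2)} := by ext; simp [A]
    rw [this]
    exact isClosed_iInter fun x => isClosed_le (by fun_prop) (by fun_prop)
  have hmin : ∀ e : E, ∃ k, (k, e) ∈ A ∧ ∀ k', (k', e) ∈ A → k ≤ k' := by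
    intro e
    have hc : IsCompact {k : cantorSet | (k, e) ∈ A} :=
      (hA.preimage (by fun_prop : Continuous fun k : cantorSet => (k, e))).isCompact
    have hne : {k : cantorSet | (k, e) ∈ A}.Nonempty := by
      obtain ⟨x, -, hx⟩ := (isCompact_univ (X := X)).exists_isMaxOn Set.univ_nonempty
        (by fun_prop : ContinuousOn (fun x => F (x, e)) Set.univ)
      obtain ⟨k, rfl⟩ := hs x
      exact ⟨k, fun y => hx (Set.mem_univ y)⟩
    obtain ⟨k, hk⟩ := hc.exists_isLeast hne
    exact ⟨k, hk.1, fun k' h => hk.2 h⟩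
  choose k hkA hkmin using hmin
  refine ⟨fun e => φ (k e), hφ.measurable.comp ?_, fun e x => hkA e x⟩
  refine Measurable.subtype_mk (p := (· ∈ cantorSet)) (f := fun e => (k e : ℝ))
    (measurable_of_Iic fun c => ?_)
  have : (fun e => (k e : ℝ)) ⁻¹' Set.Iic c =
      Prod.snd '' (A ∩ {z : cantorSet × E | (z.1 : ℝ) ≤ c}) := by
    ext e
    constructor
    · exact fun h => ⟨(k e, e), ⟨hkA e, h⟩, rfl⟩
    · rintro ⟨⟨k', e'⟩, ⟨h1, h2⟩, rfl⟩
      exact le_trans (Subtype.coe_le_coe.2 (hkmin e' k' h1)) h2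
  rw [this]
  exact (isClosedMap_snd_of_compactSpace _
    (hA.inter (isClosed_le (by fun_prop) (by fun_prop)))).measurableSet

/-- Consistency of maximizers: if the data `m n` converge to `m₀` and the limit criterion
`F (·, m₀)` has the unique maximizer `x₀`, then maximizers of `F (·, m n)` converge to `x₀`. -/
theorem tendsto_of_isMaxOn_of_unique {X E : Type*} [TopologicalSpace X] [CompactSpace X]
    [FirstCountableTopology X] [TopologicalSpace E] {F : X × E → ℝ} (hF : Continuous F)
    {x₀ : X} {m₀ : E} (huniq : ∀ x, F (x₀, m₀) ≤ F (x, m₀) → x = x₀) {m : ℕ → E}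
    (hm : Tendsto m atTop (𝓝 m₀)) {x : ℕ → X} (hx : ∀ n y, F (y, m n) ≤ F (x n, m n)) :
    Tendsto x atTop (𝓝 x₀) := by
  refine isCompact_univ.tendsto_nhds_of_unique_mapClusterPt (by simp) fun y _ hy => ?_
  obtain ⟨σ, hσ, hlim⟩ := hy.tendsto_subseq
  refine huniq y (le_of_tendsto_of_tendsto' (b := atTop)
    (f := fun n => F (x₀, m (σ n))) (g := fun n => F (x (σ n), m (σ n))) ?_ ?_ fun n => hx _ _)
  · exact (hF.tendsto _).comp (tendsto_const_nhds.prodMk_nhds (hm.comp hσ.tendsto_atTop))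
  · exact (hF.tendsto _).comp (hlim.prodMk_nhds (hm.comp hσ.tendsto_atTop))

/-! ### A second-order condition for strict local maxima -/

/-- A negative definite quadratic form is bounded above by a negative multiple of the squared
norm. -/
theorem exists_pos_quadratic_le {ι : Type*} [Fintype ι] {A : Matrix ι ι ℝ}
    (hA : (-A).PosDef) : ∃ c > 0, ∀ v : ι → ℝ, v ⬝ᵥ (A *ᵥ v) ≤ -c * ‖v‖ ^ 2 := by
  have hpos : ∀ v : ι → ℝ, v ≠ 0 → v ⬝ᵥ (A *ᵥ v) < 0 := fun v hv => by
    have := hA.dotProduct_mulVec_pos hv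
    simpa [Matrix.neg_mulVec, dotProduct_neg] using this
  have hcont : Continuous fun v : ι → ℝ => v ⬝ᵥ (A *ᵥ v) := by
    simp only [dotProduct, Matrix.mulVec]; fun_prop
  rcases (Metric.sphere (0 : ι → ℝ) 1).eq_empty_or_nonempty with h | h
  · refine ⟨1, one_pos, fun v => ?_⟩
    have hv : v = 0 := by
      by_contra hv
      have : ‖v‖⁻¹ • v ∈ Metric.sphere (0 : ι → ℝ) 1 := by
        simp [norm_smul, inv_mul_cancel₀ (norm_ne_zero_iff.2 hv)]
      simp [h] at this
    simp [hv]
  · obtain ⟨w, hw, hmax⟩ := (isCompact_sphere (0 : ι → ℝ) 1).exists_isMaxOn h hcont.continuousOn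
    have hw0 : w ≠ 0 := by rintro rfl; simp at hw
    refine ⟨-(w ⬝ᵥ (A *ᵥ w)), neg_pos.2 (hpos w hw0), fun v => ?_⟩
    by_cases hv : v = 0
    · simp [hv]
    have hn : ‖v‖ ≠ 0 := norm_ne_zero_iff.2 hv
    have hmem : ‖v‖⁻¹ • v ∈ Metric.sphere (0 : ι → ℝ) 1 := by
      simp [norm_smul, inv_mul_cancel₀ hn]
    have h1 : (‖v‖⁻¹ • v) ⬝ᵥ (A *ᵥ (‖v‖⁻¹ • v)) ≤ w ⬝ᵥ (A *ᵥ w) := hmax hmem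
    rw [Matrix.mulVec_smul, smul_dotProduct, dotProduct_smul, smul_eq_mul, smul_eq_mul] at h1
    have h2 : v ⬝ᵥ (A *ᵥ v) = ‖v‖ ^ 2 * (‖v‖⁻¹ * (‖v‖⁻¹ * (v ⬝ᵥ (A *ᵥ v)))) := by
      field_simp
    rw [h2, neg_neg, mul_comm (w ⬝ᵥ _)]
    exact mul_le_mul_of_nonneg_left h1 (by positivity)

theorem fderiv_apply_eq_sum_partialDeriv {ι : Type*} [Fintype ι] [DecidableEq ι]
    (f : (ι → ℝ) → ℝ) (x v : ι → ℝ) : fderiv ℝ f x v = ∑ a, v a * partialDeriv f a x := by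
  conv_lhs => rw [pi_eq_sum_univ' v]
  simp [partialDeriv, map_sum]

/-- Second-order sufficient condition for a strict local maximum: the gradient vanishes and the
Hessian is negative definite. Differentiability of the gradient at the single point `x₀` makes the
slope of `f` along every short ray from `x₀` negative. -/
theorem eventually_lt_of_hessian_negDef {ι : Type*} [Fintype ι] [DecidableEq ι]
    {f : (ι → ℝ) → ℝ} {x₀ : ι → ℝ} (hd : ∀ᶠ x in 𝓝 x₀, DifferentiableAt ℝ f x)
    (hd2 : ∀ a, DifferentiableAt ℝ (partialDeriv f a) x₀) (hg : ∀ a, partialDeriv f a x₀ = 0)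
    (hH : (-(hessianMat f x₀)).PosDef) :
    ∃ r > 0, ∀ x ∈ Metric.closedBall x₀ r, x ≠ x₀ → f x < f x₀ := by
  obtain ⟨c, hc, hquad⟩ := exists_pos_quadratic_le hH
  -- the gradient as a vector-valued map, with derivative the Hessian
  let G : (ι → ℝ) → (ι → ℝ) := fun x a => partialDeriv f a x
  have hG : HasFDerivAt G (ContinuousLinearMap.pi fun a => fderiv ℝ (partialDeriv f a) x₀) x₀ :=
    hasFDerivAt_pi.2 fun a => (hd2 a).hasFDerivAt
  have hG0 : G x₀ = 0 := funext hg
  have hcard : (0 : ℝ) < Fintype.card ι + 1 := by positivity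
  -- the constant makes the remainder, summed over coordinates, at most `c / 2 * ‖v‖ ^ 2`
  have hsmall := hG.isLittleO.def (c := c / 2 / (Fintype.card ι + 1)) (by positivity)
  obtain ⟨r, hr, hball⟩ := Metric.eventually_nhds_iff_ball.1 (hsmall.and hd)
  have hslope : ∀ v : ι → ℝ, v ≠ 0 → ‖v‖ < r → fderiv ℝ f (x₀ + v) v < 0 := by
    intro v hv hvr
    have h1 := (hball (x₀ + v) (by simpa using hvr)).1
    rw [hG0, sub_zero, add_sub_cancel_left] at h1
    set R := G (x₀ + v) - (ContinuousLinearMap.pi fun a => fderiv ℝ (partialDeriv f a) x₀) v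
      with hR
    have h2 : fderiv ℝ f (x₀ + v) v = v ⬝ᵥ (hessianMat f x₀ *ᵥ v) + v ⬝ᵥ R := by
      rw [fderiv_apply_eq_sum_partialDeriv]
      have : G (x₀ + v) = (fun b => ∑ a, v a * hessianMat f x₀ a b) + R := by
        rw [hR]
        funext b
        simp [hessianMat, fderiv_apply_eq_sum_partialDeriv]
      have h3 : ∑ a, v a * partialDeriv f a (x₀ + v) = v ⬝ᵥ G (x₀ + v) := rfl
      rw [h3, this, dotProduct_add]
      congr 1
      rw [Matrix.dotProduct_mulVec, dotProduct_comm]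
      rfl
    have h4 : v ⬝ᵥ R ≤ c / 2 * ‖v‖ ^ 2 := by
      have : v ⬝ᵥ R ≤ ∑ _a : ι, ‖v‖ * (c / 2 / (Fintype.card ι + 1) * ‖v‖) := by
        refine Finset.sum_le_sum fun a _ => ?_
        refine (le_abs_self _).trans ?_
        rw [abs_mul]
        exact mul_le_mul (norm_le_pi_norm v a) ((norm_le_pi_norm R a).trans h1) (abs_nonneg _)
          (norm_nonneg _)
      refine this.trans ?_
      rw [Finset.sum_const, Finset.card_univ, nsmul_eq_mul]
      have h5 : (Fintype.card ι : ℝ) * (‖v‖ * (c / 2 / (Fintype.card ι + 1) * ‖v‖)) =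
          (Fintype.card ι / (Fintype.card ι + 1)) * (c / 2 * ‖v‖ ^ 2) := by
        field_simp
      rw [h5]
      refine mul_le_of_le_one_left (by positivity) ?_
      rw [div_le_one hcard]
      linarith
    have h6 : 0 < ‖v‖ ^ 2 := by have := norm_pos_iff.2 hv; positivity
    rw [h2]
    nlinarith [hquad v]
  refine ⟨r / 2, by positivity, fun x hx hne => ?_⟩
  set v := x - x₀ with hv
  have hv0 : v ≠ 0 := sub_ne_zero.2 hne
  have hvr : ‖v‖ < r := by
    have : ‖v‖ ≤ r / 2 := by simpa [dist_eq_norm] using hx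
    linarith
  have hderiv : ∀ τ ∈ Set.Icc (0 : ℝ) 1,
      HasDerivAt (fun τ : ℝ => f (x₀ + τ • v)) (fderiv ℝ f (x₀ + τ • v) v) τ := by
    intro τ hτ
    have h1 : DifferentiableAt ℝ f (x₀ + τ • v) := by
      refine (hball _ ?_).2
      rw [Metric.mem_ball, dist_eq_norm, add_sub_cancel_left, norm_smul, Real.norm_eq_abs,
        abs_of_nonneg hτ.1]
      exact (mul_le_of_le_one_left (norm_nonneg _) hτ.2).trans_lt hvr
    have h2 : HasDerivAt (fun τ : ℝ => x₀ + τ • v) v τ := by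
      simpa using ((hasDerivAt_id τ).smul_const v).const_add x₀
    exact h1.hasFDerivAt.comp_hasDerivAt τ h2
  have hanti : StrictAntiOn (fun τ : ℝ => f (x₀ + τ • v)) (Set.Icc 0 1) := by
    refine strictAntiOn_of_deriv_neg (convex_Icc 0 1)
      (fun τ hτ => (hderiv τ hτ).continuousAt.continuousWithinAt) fun τ hτ => ?_
    rw [interior_Icc] at hτ
    rw [(hderiv τ (Set.Ioo_subset_Icc_self hτ)).deriv]
    have h1 := hslope (τ • v) (smul_ne_zero hτ.1.ne' hv0) (by
      rw [norm_smul, Real.norm_eq_abs, abs_of_pos hτ.1]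
      exact (mul_le_of_le_one_left (norm_nonneg _) hτ.2.le).trans_lt hvr)
    rw [map_smul, smul_eq_mul] at h1
    exact (pos_iff_neg_of_mul_neg h1).1 hτ.1
  have := hanti (Set.left_mem_Icc.2 zero_le_one) (Set.right_mem_Icc.2 zero_le_one) one_pos
  simpa [hv] using this

/-! ### Derivatives of determinants and inverses -/

section MatrixCalculus

variable {E : Type*} [NormedAddCommGroup E] [NormedSpace ℝ E] {n : Type*} [Fintype n]
  [DecidableEq n] {k : WithTop ℕ∞} {A : E → Matrix n n ℝ} {x : E}

theorem contDiffAt_det (hA : ∀ i j, ContDiffAt ℝ k (fun y => A y i j) x) :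
    ContDiffAt ℝ k (fun y => (A y).det) x := by
  simp only [Matrix.det_apply']
  exact ContDiffAt.sum fun σ _ => contDiffAt_const.mul (contDiffAt_prod fun i _ => hA _ _)

theorem contDiffAt_inv_entry (hA : ∀ i j, ContDiffAt ℝ k (fun y => A y i j) x)
    (hdet : (A x).det ≠ 0) (i j : n) : ContDiffAt ℝ k (fun y => (A y)⁻¹ i j) x := by
  simp only [Matrix.inv_def, Ring.inverse_eq_inv', Matrix.smul_apply, smul_eq_mul,
    Matrix.adjugate_apply]
  refine ((contDiffAt_det hA).inv hdet).mul (contDiffAt_det fun a b => ?_)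
  by_cases h : a = j
  · subst h; simpa [Matrix.updateRow_self] using contDiffAt_const
  · simpa [Matrix.updateRow_ne h] using hA a b

/-- Jacobi's formula along a line, in logarithmic form. -/
theorem hasDerivAt_log_det {A : Matrix n n ℝ} (hA : A.det ≠ 0) (B : Matrix n n ℝ) :
    HasDerivAt (fun τ : ℝ => Real.log (A + τ • B).det) (A⁻¹ * B).trace 0 := by
  have hu : IsUnit A.det := isUnit_iff_ne_zero.2 hA
  have h1 : ∀ τ : ℝ, (A + τ • B).det = A.det * (1 + τ • (A⁻¹ * B)).det := fun τ => by
    rw [← Matrix.det_mul, mul_add, mul_one, Matrix.mul_smul,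
      Matrix.mul_nonsing_inv_cancel_left _ _ hu]
  have h2 : HasDerivAt (fun τ : ℝ => (A + τ • B).det) (A.det * (A⁻¹ * B).trace) 0 := by
    simp_rw [h1]
    refine HasDerivAt.const_mul _ ?_
    have h3 : (fun τ : ℝ => (1 + τ • (A⁻¹ * B)).det) = _ :=
      funext fun τ => Matrix.det_one_add_smul τ (A⁻¹ * B)
    rw [h3]
    set p := (Matrix.det (1 + (Polynomial.X : Polynomial ℝ) • (A⁻¹ * B).map Polynomial.C)).divX.divX
    have h4 : HasDerivAt (fun τ : ℝ => τ) 1 0 := hasDerivAt_id 0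
    exact (((h4.const_mul (A⁻¹ * B).trace).const_add 1).add
      ((p.hasDerivAt 0).mul (h4.pow 2))).congr_deriv (by simp)
  have h3 := h2.log (by simpa using hA)
  simpa [mul_div_cancel_left₀ _ hA] using h3

/-- The derivative of `τ ↦ r' (A + τ B)⁻¹ r` at `0`, from the resolvent identity
`(A + τ B)⁻¹ = A⁻¹ - τ A⁻¹ B (A + τ B)⁻¹`. -/
theorem hasDerivAt_quadForm_inv {A : Matrix n n ℝ} (hA : A.det ≠ 0) (B : Matrix n n ℝ)
    (r : n → ℝ) : HasDerivAt (fun τ : ℝ => r ⬝ᵥ ((A + τ • B)⁻¹ *ᵥ r))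
      (-(r ⬝ᵥ ((A⁻¹ * B * A⁻¹) *ᵥ r))) 0 := by
  have hu : IsUnit A.det := isUnit_iff_ne_zero.2 hA
  have hent : ∀ i j, ContDiffAt ℝ 1 (fun τ : ℝ => (A + τ • B) i j) 0 := fun i j => by
    simp only [Matrix.add_apply, Matrix.smul_apply, smul_eq_mul]
    fun_prop
  have hinv := contDiffAt_inv_entry hent (by simpa using hA)
  set h : ℝ → ℝ := fun τ => r ⬝ᵥ ((A⁻¹ * B * (A + τ • B)⁻¹) *ᵥ r) with hh
  have hdiff : DifferentiableAt ℝ h 0 := by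
    simp only [hh, dotProduct, Matrix.mulVec, Matrix.mul_apply (N := (A + _ • B)⁻¹)]
    refine DifferentiableAt.fun_sum fun i _ => DifferentiableAt.const_mul
      (DifferentiableAt.fun_sum fun j _ => DifferentiableAt.mul_const
        (DifferentiableAt.fun_sum fun l _ => DifferentiableAt.const_mul ?_ _) _) _
    exact (hinv l j).differentiableAt (by norm_num)
  have hev : (fun τ : ℝ => r ⬝ᵥ ((A + τ • B)⁻¹ *ᵥ r)) =ᶠ[𝓝 0]
      fun τ => r ⬝ᵥ (A⁻¹ *ᵥ r) - τ * h τ := by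
    have hc : ContinuousAt (fun τ : ℝ => (A + τ • B).det) 0 :=
      (contDiffAt_det hent).continuousAt
    filter_upwards [hc.eventually_ne (by simpa using hA : (A + (0 : ℝ) • B).det ≠ 0)] with τ hτ
    have hres : (A + τ • B)⁻¹ = A⁻¹ - τ • (A⁻¹ * B * (A + τ • B)⁻¹) := by
      have e1 : A⁻¹ * (A + τ • B) * (A + τ • B)⁻¹ = A⁻¹ :=
        Matrix.mul_nonsing_inv_cancel_right _ _ (isUnit_iff_ne_zero.2 hτ)
      rw [mul_add, Matrix.nonsing_inv_mul _ hu, add_mul, one_mul, Matrix.mul_smul,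
        Matrix.smul_mul] at e1
      exact eq_sub_of_add_eq e1
    conv_lhs => rw [hres]
    rw [Matrix.sub_mulVec, dotProduct_sub, Matrix.smul_mulVec, dotProduct_smul, smul_eq_mul]
  refine HasDerivAt.congr_of_eventuallyEq ?_ hev
  have := ((hasDerivAt_id (0 : ℝ)).mul hdiff.hasDerivAt).const_sub (r ⬝ᵥ (A⁻¹ *ᵥ r))
  simpa [hh] using this

end MatrixCalculus

/-! ### Partial derivatives and Hessians of linear combinations -/

section PartialDerivatives

variable {ι : Type*} [Fintype ι] [DecidableEq ι] {J : Type*} [Fintype J]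

theorem partialDeriv_eq_of_hasDerivAt {f : (ι → ℝ) → ℝ} {x : ι → ℝ} {a : ι} {d : ℝ}
    (hf : DifferentiableAt ℝ f x)
    (h : HasDerivAt (fun τ : ℝ => f (x + τ • Pi.single a 1)) d 0) : partialDeriv f a x = d := by
  have h2 : HasDerivAt (fun τ : ℝ => x + τ • (Pi.single a 1 : ι → ℝ)) (Pi.single a 1) 0 := by
    simpa using ((hasDerivAt_id (0 : ℝ)).smul_const (Pi.single a 1 : ι → ℝ)).const_add x
  have hf' : HasFDerivAt f (fderiv ℝ f x) (x + (0 : ℝ) • (Pi.single a 1 : ι → ℝ)) := by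
    simpa using hf.hasFDerivAt
  exact (hf'.comp_hasDerivAt 0 h2).unique h

theorem ContDiffAt.partialDeriv {f : (ι → ℝ) → ℝ} {x : ι → ℝ} {m k : WithTop ℕ∞}
    (hf : ContDiffAt ℝ k f x) (hmk : m + 1 ≤ k) (a : ι) :
    ContDiffAt ℝ m (partialDeriv f a) x :=
  (hf.fderiv_right hmk).clm_apply contDiffAt_const

theorem partialDeriv_sum_mul {G : J → (ι → ℝ) → ℝ} {x : ι → ℝ}
    (hG : ∀ j, DifferentiableAt ℝ (G j) x) (m : J → ℝ) (a : ι) :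
    partialDeriv (fun y => ∑ j, G j y * m j) a x = ∑ j, partialDeriv (G j) a x * m j := by
  have : HasFDerivAt (fun y => ∑ j, G j y * m j) (∑ j, m j • fderiv ℝ (G j) x) x :=
    HasFDerivAt.fun_sum fun j _ => (hG j).hasFDerivAt.mul_const (m j)
  simp [partialDeriv, this.fderiv, mul_comm]

theorem hessianMat_sum_mul {G : J → (ι → ℝ) → ℝ} {x : ι → ℝ}
    (hG : ∀ j, ContDiffAt ℝ 2 (G j) x) (m : J → ℝ) (a b : ι) :
    hessianMat (fun y => ∑ j, G j y * m j) x a b = ∑ j, hessianMat (G j) x a b * m j := by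
  have hev : partialDeriv (fun y => ∑ j, G j y * m j) b =ᶠ[𝓝 x]
      fun y => ∑ j, partialDeriv (G j) b y * m j := by
    have : ∀ᶠ y in 𝓝 x, ∀ j, ContDiffAt ℝ 2 (G j) y :=
      eventually_all.2 fun j => (hG j).eventually (by simp)
    filter_upwards [this] with y hy
    exact partialDeriv_sum_mul (fun j => (hy j).differentiableAt (by norm_num)) m b
  have h1 : hessianMat (fun y => ∑ j, G j y * m j) x a b =
      partialDeriv (fun y => ∑ j, partialDeriv (G j) b y * m j) a x := by
    simp only [hessianMat, Matrix.of_apply]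
    rw [partialDeriv, hev.fderiv_eq, partialDeriv]
  rw [h1, partialDeriv_sum_mul fun j =>
    ((hG j).partialDeriv (m := 1) (by norm_num) b).differentiableAt (by norm_num)]
  rfl

end PartialDerivatives

/-! ### The quasi log-likelihood as a linear function of moments -/

section Criterion

variable {q p K T : ℕ}

theorem ofVech_isSymm (ω : VechIdx T → ℝ) : (ofVech ω).IsSymm := by
  ext s t
  simp only [Matrix.transpose_apply, ofVech, Matrix.of_apply]
  rcases lt_trichotomy s t with h | rfl | h
  · simp [h.le, h.not_ge]
  · rfl
  · simp [h.le, h.not_ge]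

theorem omegaOf_isSymm (ψ : PsiIdx q p K T → ℝ) : (omegaOf ψ).IsSymm := ofVech_isSymm _

theorem ofVech_add_smul (ω ω' : VechIdx T → ℝ) (τ : ℝ) :
    ofVech (ω + τ • ω') = ofVech ω + τ • ofVech ω' := by
  ext s t
  simp only [ofVech, Matrix.of_apply, Matrix.add_apply, Matrix.smul_apply]
  split_ifs <;> simp

theorem contDiff_omegaOf_entry {k : WithTop ℕ∞} (s t : Fin T) :
    ContDiff ℝ k fun ψ : PsiIdx q p K T → ℝ => omegaOf ψ s t := by
  simp only [omegaOf, ofVech, Matrix.of_apply]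
  split_ifs <;> fun_prop

/-- A perturbation of `Ω` whose entries are small compared with the least value of its quadratic
form on the unit sphere stays positive definite. -/
theorem isOpen_paramSpace : IsOpen (paramSpace q p K T) := by
  rw [isOpen_iff_mem_nhds]
  intro ψ hψ
  have hψ' : (omegaOf ψ).PosDef := hψ
  obtain ⟨c, hc, hquad⟩ := exists_pos_quadratic_le (A := -omegaOf ψ) (by simpa using hψ')
  set δ : ℝ := c / (2 * (T + 1) ^ 2) with hδ
  have hδ0 : 0 < δ := by positivity
  have hnear : ∀ᶠ φ in 𝓝 ψ, ∀ s t, |omegaOf φ s t - omegaOf ψ s t| < δ := by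
    refine eventually_all.2 fun s => eventually_all.2 fun t => ?_
    exact Metric.tendsto_nhds.1
      ((contDiff_omegaOf_entry (k := 0) s t).continuous.tendsto ψ) δ hδ0
  filter_upwards [hnear] with φ hφ
  refine Matrix.PosDef.of_dotProduct_mulVec_pos ?_ fun v hv => ?_
  · exact (Matrix.isHermitian_iff_isSymm).2 (ofVech_isSymm _)
  have h1 := hquad v
  have h2 : |v ⬝ᵥ ((omegaOf φ - omegaOf ψ) *ᵥ v)| ≤ c / 2 * ‖v‖ ^ 2 := by
    have : |v ⬝ᵥ ((omegaOf φ - omegaOf ψ) *ᵥ v)| ≤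
        ∑ _s : Fin T, ‖v‖ * ∑ _t : Fin T, δ * ‖v‖ := by
      refine (Finset.abs_sum_le_sum_abs
        (fun s => v s * ((omegaOf φ - omegaOf ψ) *ᵥ v) s) Finset.univ).trans
        (Finset.sum_le_sum fun s _ => ?_)
      rw [abs_mul]
      refine mul_le_mul (norm_le_pi_norm v s) ?_ (abs_nonneg _) (norm_nonneg _)
      refine (Finset.abs_sum_le_sum_abs
        (fun t => (omegaOf φ - omegaOf ψ) s t * v t) Finset.univ).trans
        (Finset.sum_le_sum fun t _ => ?_)
      rw [abs_mul]
      exact mul_le_mul (hφ s t).le (norm_le_pi_norm v t) (abs_nonneg _) hδ0.le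
    refine this.trans ?_
    simp only [Finset.sum_const, Finset.card_univ, Fintype.card_fin, nsmul_eq_mul]
    have e : (T : ℝ) * (‖v‖ * (T * (δ * ‖v‖))) = (T ^ 2 / (T + 1) ^ 2) * (c / 2 * ‖v‖ ^ 2) := by
      rw [hδ]; field_simp
    rw [e]
    refine mul_le_of_le_one_left (by positivity) ?_
    rw [div_le_one (by positivity)]
    gcongr
    linarith
  have h3 : v ⬝ᵥ (omegaOf φ *ᵥ v) =
      v ⬝ᵥ ((omegaOf φ - omegaOf ψ) *ᵥ v) - v ⬝ᵥ (-omegaOf ψ *ᵥ v) := by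
    rw [← dotProduct_sub, ← Matrix.sub_mulVec]; simp
  have h4 : 0 < ‖v‖ ^ 2 := by have := norm_pos_iff.2 hv; positivity
  rw [star_trivial, h3]
  nlinarith [(abs_le.1 h2).1]

/-- The variables of the augmented regression at one date: the dependent variable (index `none`)
and the regressors, i.e. the entries of the row of `W`. -/
noncomputable def augReg (κ : Fin T → Fin K → Fin q) (o : Obs q p T) (t : Fin T) :
    Option (GammaIdx q p K) → ℝ
  | none => yCur o t
  | some a => wMat κ o t a

/-- The coefficients `(1, -γ')'` with which the variables `augReg` enter the residual. -/
noncomputable def augCoef (γ : GammaIdx q p K → ℝ) : Option (GammaIdx q p K) → ℝ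
  | none => 1
  | some a => -γ a

/-- Index set of the sample moments on which the quasi log-likelihood depends: `none` for the
constant `1`, the others for products of two variables of the augmented regression. -/
abbrev MomIdx (q p K T : ℕ) : Type :=
  Option ((Fin T × Option (GammaIdx q p K)) × (Fin T × Option (GammaIdx q p K)))

/-- The statistics in which the quasi log-likelihood of an observation is linear. -/
noncomputable def augMoment (κ : Fin T → Fin K → Fin q) (o : Obs q p T) : MomIdx q p K T → ℝ
  | none => 1
  | some (sa, tb) => augReg κ o sa.1 sa.2 * augReg κ o tb.1 tb.2

/-- The coefficients of `augMoment` in the quasi log-likelihood. -/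
noncomputable def momCoef : MomIdx q p K T → (PsiIdx q p K T → ℝ) → ℝ
  | none => fun ψ => -((T : ℝ) / 2) * Real.log (2 * Real.pi) - 1 / 2 * Real.log (omegaOf ψ).det
  | some (sa, tb) => fun ψ =>
      -(1 / 2) * ((omegaOf ψ)⁻¹ sa.1 tb.1 *
        (augCoef (gammaOf ψ) sa.2 * augCoef (gammaOf ψ) tb.2))

/-- The quasi log-likelihood as a function of the parameter and of the values of the moments. -/
noncomputable def critFn (m : MomIdx q p K T → ℝ) (ψ : PsiIdx q p K T → ℝ) : ℝ :=
  ∑ j, momCoef j ψ * m j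

/-- The sample averages of `augMoment`. -/
noncomputable def avgMoment (κ : Fin T → Fin K → Fin q) {N : ℕ} (w : Fin N → Obs q p T)
    (j : MomIdx q p K T) : ℝ := (N : ℝ)⁻¹ * ∑ i, augMoment κ (w i) j

theorem resid_eq_sum (κ : Fin T → Fin K → Fin q) (o : Obs q p T) (γ : GammaIdx q p K → ℝ)
    (t : Fin T) : resid κ o γ t = ∑ a, augCoef γ a * augReg κ o t a := by
  rw [Fintype.sum_option]
  simp [resid, augCoef, augReg, Matrix.mulVec, dotProduct, sub_eq_add_neg, mul_comm,
    Finset.sum_neg_distrib]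

theorem logLik_eq_critFn (κ : Fin T → Fin K → Fin q) (o : Obs q p T) (ψ : PsiIdx q p K T → ℝ) :
    logLik κ o ψ = critFn (augMoment κ o) ψ := by
  rw [critFn, Fintype.sum_option, logLik]
  have : resid κ o (gammaOf ψ) ⬝ᵥ ((omegaOf ψ)⁻¹ *ᵥ resid κ o (gammaOf ψ)) =
      ∑ x : (Fin T × Option (GammaIdx q p K)) × (Fin T × Option (GammaIdx q p K)),
        (omegaOf ψ)⁻¹ x.1.1 x.2.1 * (augCoef (gammaOf ψ) x.1.2 * augCoef (gammaOf ψ) x.2.2) *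
          (augReg κ o x.1.1 x.1.2 * augReg κ o x.2.1 x.2.2) := by
    simp only [dotProduct, Matrix.mulVec, resid_eq_sum, Fintype.sum_prod_type, Finset.sum_mul,
      Finset.mul_sum]
    refine Finset.sum_congr rfl fun s _ => ?_
    refine (Finset.sum_congr rfl fun t _ => Finset.sum_comm).trans ?_
    rw [Finset.sum_comm]
    refine Finset.sum_congr rfl fun a _ => Finset.sum_congr rfl fun t _ =>
      Finset.sum_congr rfl fun b _ => by ring
  rw [this, Finset.mul_sum, sub_eq_add_neg, ← Finset.sum_neg_distrib]
  simp only [momCoef, augMoment, mul_one]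
  refine congrArg _ ?_
  exact Finset.sum_congr rfl fun x _ => by ring

theorem avgLogLik_eq_critFn (κ : Fin T → Fin K → Fin q) {N : ℕ} (w : Fin N → Obs q p T) :
    avgLogLik κ w = critFn (avgMoment κ w) := by
  funext ψ
  simp only [avgLogLik, logLik_eq_critFn, critFn, avgMoment]
  rw [Finset.sum_comm, Finset.mul_sum]
  refine Finset.sum_congr rfl fun j _ => ?_
  rw [← Finset.mul_sum]
  ring

theorem contDiffAt_momCoef {k : WithTop ℕ∞} {ψ : PsiIdx q p K T → ℝ}
    (hψ : ψ ∈ paramSpace q p K T) (j : MomIdx q p K T) : ContDiffAt ℝ k (momCoef j) ψ := by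
  have hdet : (omegaOf ψ).det ≠ 0 := (Matrix.PosDef.det_pos hψ).ne'
  have hent : ∀ s t, ContDiffAt ℝ k (fun ψ : PsiIdx q p K T → ℝ => omegaOf ψ s t) ψ :=
    fun s t => (contDiff_omegaOf_entry s t).contDiffAt
  rcases j with _ | ⟨⟨s, a⟩, ⟨t, b⟩⟩
  · exact contDiffAt_const.sub (contDiffAt_const.mul ((contDiffAt_det hent).log hdet))
  · have hc : ∀ a, ContDiffAt ℝ k
        (fun ψ : PsiIdx q p K T → ℝ => augCoef (gammaOf ψ) a) ψ := by
      rintro (_ | a)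
      · exact contDiffAt_const
      · simp only [augCoef, gammaOf]; fun_prop
    exact contDiffAt_const.mul ((contDiffAt_inv_entry hent hdet s t).mul ((hc a).mul (hc b)))

theorem contDiffAt_critFn {k : WithTop ℕ∞} {ψ : PsiIdx q p K T → ℝ}
    (hψ : ψ ∈ paramSpace q p K T) (m : MomIdx q p K T → ℝ) : ContDiffAt ℝ k (critFn m) ψ :=
  ContDiffAt.sum fun j _ => (contDiffAt_momCoef hψ j).mul contDiffAt_const

theorem partialDeriv_critFn {ψ : PsiIdx q p K T → ℝ} (hψ : ψ ∈ paramSpace q p K T)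
    (m : MomIdx q p K T → ℝ) (a : PsiIdx q p K T) :
    partialDeriv (critFn m) a ψ = ∑ j, partialDeriv (momCoef j) a ψ * m j :=
  partialDeriv_sum_mul
    (fun j => (contDiffAt_momCoef (k := 1) hψ j).differentiableAt (by norm_num)) m a

theorem hessianMat_critFn {ψ : PsiIdx q p K T → ℝ} (hψ : ψ ∈ paramSpace q p K T)
    (m : MomIdx q p K T → ℝ) (a b : PsiIdx q p K T) :
    hessianMat (critFn m) ψ a b = ∑ j, hessianMat (momCoef j) ψ a b * m j :=
  hessianMat_sum_mul (contDiffAt_momCoef hψ) m a b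

/-- The score of one observation for a regression coefficient: an entry of `W' Ω⁻¹ u(γ)`. -/
theorem partialDeriv_logLik_inl (κ : Fin T → Fin K → Fin q) (o : Obs q p T)
    {ψ : PsiIdx q p K T → ℝ} (hψ : ψ ∈ paramSpace q p K T) (g : GammaIdx q p K) :
    partialDeriv (logLik κ o) (Sum.inl g) ψ =
      ∑ t, wMat κ o t g * ((omegaOf ψ)⁻¹ *ᵥ resid κ o (gammaOf ψ)) t := by
  set Λ := (omegaOf ψ)⁻¹ with hΛ
  set r := resid κ o (gammaOf ψ) with hr
  set d : Fin T → ℝ := fun t => wMat κ o t g with hd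
  have hsymm : Λ.IsSymm := by
    rw [Matrix.IsSymm, hΛ, Matrix.transpose_nonsing_inv, (omegaOf_isSymm ψ).eq]
  have hdiff : DifferentiableAt ℝ (logLik κ o) ψ := by
    rw [funext (logLik_eq_critFn κ o)]
    exact (contDiffAt_critFn (k := 1) hψ _).differentiableAt (by norm_num)
  refine partialDeriv_eq_of_hasDerivAt hdiff ?_
  have hω : ∀ τ : ℝ, omegaOf (ψ + τ • Pi.single (Sum.inl g) 1) = omegaOf ψ := fun τ => by
    simp [omegaOf]
  have hres : ∀ τ : ℝ, resid κ o (gammaOf (ψ + τ • Pi.single (Sum.inl g) 1)) = r - τ • d := by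
    intro τ
    have : gammaOf (ψ + τ • Pi.single (Sum.inl g) 1) = gammaOf ψ + τ • Pi.single g 1 := by
      funext a
      by_cases h : a = g
      · subst h; simp [gammaOf]
      · simp [gammaOf, h]
    rw [this, resid, Matrix.mulVec_add, Matrix.mulVec_smul, Matrix.mulVec_single_one, ← sub_sub]
    rfl
  have hcross : d ⬝ᵥ (Λ *ᵥ r) = r ⬝ᵥ (Λ *ᵥ d) := by
    rw [Matrix.dotProduct_mulVec, ← Matrix.mulVec_transpose, hsymm.eq, dotProduct_comm]
  have hquad : ∀ τ : ℝ, logLik κ o (ψ + τ • Pi.single (Sum.inl g) 1) =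
      logLik κ o ψ + (τ * (d ⬝ᵥ (Λ *ᵥ r)) - 1 / 2 * (τ ^ 2 * (d ⬝ᵥ (Λ *ᵥ d)))) := fun τ => by
    rw [logLik, logLik, hω, hres, ← hr, ← hΛ, Matrix.mulVec_sub, Matrix.mulVec_smul,
      dotProduct_sub, sub_dotProduct, sub_dotProduct, smul_dotProduct, dotProduct_smul,
      smul_dotProduct, dotProduct_smul, ← hcross]
    simp only [smul_eq_mul]
    ring
  simp only [hquad]
  have h0 : HasDerivAt (fun τ : ℝ => τ) 1 0 := hasDerivAt_id 0
  have := ((h0.mul_const (d ⬝ᵥ (Λ *ᵥ r))).sub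
    (((h0.pow 2).mul_const (d ⬝ᵥ (Λ *ᵥ d))).const_mul (1 / 2))).const_add (logLik κ o ψ)
  simpa [dotProduct] using this

/-- The score of one observation for an element of `Ω`, in the direction `B = ∂Ω/∂ω_a`. -/
theorem partialDeriv_logLik_inr (κ : Fin T → Fin K → Fin q) (o : Obs q p T)
    {ψ : PsiIdx q p K T → ℝ} (hψ : ψ ∈ paramSpace q p K T) (a : VechIdx T) :
    partialDeriv (logLik κ o) (Sum.inr a) ψ =
      -(1 / 2) * ((omegaOf ψ)⁻¹ * ofVech (Pi.single a 1)).trace +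
        1 / 2 * (resid κ o (gammaOf ψ) ⬝ᵥ
          (((omegaOf ψ)⁻¹ * ofVech (Pi.single a 1) * (omegaOf ψ)⁻¹) *ᵥ
            resid κ o (gammaOf ψ))) := by
  have hdet : (omegaOf ψ).det ≠ 0 := (Matrix.PosDef.det_pos hψ).ne'
  have hdiff : DifferentiableAt ℝ (logLik κ o) ψ := by
    rw [funext (logLik_eq_critFn κ o)]
    exact (contDiffAt_critFn (k := 1) hψ _).differentiableAt (by norm_num)
  refine partialDeriv_eq_of_hasDerivAt hdiff ?_
  have hγ : ∀ τ : ℝ, gammaOf (ψ + τ • Pi.single (Sum.inr a) 1) = gammaOf ψ := fun τ => by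
    funext b; simp [gammaOf]
  have hω : ∀ τ : ℝ, omegaOf (ψ + τ • Pi.single (Sum.inr a) 1) =
      omegaOf ψ + τ • ofVech (Pi.single a 1) := fun τ => by
    rw [omegaOf, omegaOf, ← ofVech_add_smul]
    congr 1
    funext b
    by_cases h : b = a
    · subst h; simp
    · simp [h]
  have := (((hasDerivAt_log_det hdet (ofVech (Pi.single a 1))).const_mul (1 / 2)).const_sub
    (-((T : ℝ) / 2) * Real.log (2 * Real.pi))).sub
    ((hasDerivAt_quadForm_inv hdet (ofVech (Pi.single a 1)) (resid κ o (gammaOf ψ))).const_mul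
      (1 / 2))
  simp only [logLik, hγ, hω]
  exact this.congr_deriv (by ring)

end Criterion

/-! ### Moment bounds -/

section Moments

variable {q p K T : ℕ} {S : Type*} [MeasurableSpace S] {P : Measure S}

/-- The coordinates of an observation, together with the constant `1` (index `none`). -/
def coord (o : Obs q p T) : Option (Fin q ⊕ Fin (p + T)) → ℝ
  | none => 1
  | some (Sum.inl k) => o.1 k
  | some (Sum.inr r) => o.2 r

theorem measurable_coord (c : Option (Fin q ⊕ Fin (p + T))) :
    Measurable fun o : Obs q p T => coord o c := by
  rcases c with _ | k | r <;> simp only [coord] <;> fun_prop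

theorem exists_coord_eq_augReg (κ : Fin T → Fin K → Fin q) (t : Fin T)
    (a : Option (GammaIdx q p K)) : ∃ c, ∀ o : Obs q p T, augReg κ o t a = coord o c := by
  rcases a with _ | (j | k) | (_ | (k | j))
  · exact ⟨some (Sum.inr (Fin.natAdd p t)), fun o => rfl⟩
  · exact ⟨some (Sum.inr ⟨p + t.val - (j.val + 1), by omega⟩), fun o => rfl⟩
  · exact ⟨some (Sum.inl (κ t k)), fun o => rfl⟩
  · exact ⟨none, fun o => rfl⟩
  · exact ⟨some (Sum.inl k), fun o => rfl⟩
  · exact ⟨some (Sum.inr (Fin.castAdd T j.rev)), fun o => rfl⟩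

theorem exists_coord_mul_eq_augMoment (κ : Fin T → Fin K → Fin q) (j : MomIdx q p K T) :
    ∃ c d, ∀ o : Obs q p T, augMoment κ o j = coord o c * coord o d := by
  rcases j with _ | ⟨⟨s, a⟩, ⟨t, b⟩⟩
  · exact ⟨none, none, fun o => (mul_one 1).symm⟩
  · obtain ⟨c, hc⟩ := exists_coord_eq_augReg (p := p) κ s a
    obtain ⟨d, hd⟩ := exists_coord_eq_augReg (p := p) κ t b
    exact ⟨c, d, fun o => by rw [augMoment, hc, hd]⟩

theorem integrable_abs_rpow_of_lintegral_lt {f : S → ℝ} (hf : Measurable f) {ρ : ℝ} (hρ : 0 ≤ ρ)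
    {M : ℝ≥0} (h : ∫⁻ s, ‖f s‖ₑ ^ ρ ∂P < M) :
    Integrable (fun s => |f s| ^ ρ) P ∧ ∫ s, |f s| ^ ρ ∂P ≤ M := by
  have he : ∀ s, ‖|f s| ^ ρ‖ₑ = ‖f s‖ₑ ^ ρ := fun s => by
    rw [Real.enorm_of_nonneg (by positivity), ← ENNReal.ofReal_rpow_of_nonneg (abs_nonneg _) hρ,
      Real.enorm_eq_ofReal_abs]
  have hm : Measurable fun s => |f s| ^ ρ := by fun_prop
  refine ⟨⟨hm.aestronglyMeasurable, ?_⟩, ?_⟩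
  · rw [hasFiniteIntegral_def]
    simp only [he]
    exact h.trans ENNReal.coe_lt_top
  · rw [integral_eq_lintegral_of_nonneg_ae (Eventually.of_forall fun s => by positivity)
      hm.aestronglyMeasurable]
    refine ENNReal.toReal_le_of_le_ofReal M.2 ?_
    have : ∫⁻ s, ENNReal.ofReal (|f s| ^ ρ) ∂P = ∫⁻ s, ‖f s‖ₑ ^ ρ ∂P :=
      lintegral_congr fun s => by rw [← he, Real.enorm_of_nonneg (by positivity)]
    rw [this]
    simpa using h.le

theorem abs_mul_rpow_le {a b η ρ : ℝ} (hη : 0 ≤ η) (h : 2 * η ≤ ρ) :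
    |a * b| ^ η ≤ 1 + |a| ^ ρ + |b| ^ ρ := by
  set m := max 1 (max |a| |b|) with hm
  have hm1 : 1 ≤ m := le_max_left _ _
  have ha : |a| ≤ m := (le_max_left _ _).trans (le_max_right _ _)
  have hb : |b| ≤ m := (le_max_right _ _).trans (le_max_right _ _)
  have h1 : |a * b| ^ η ≤ m ^ ρ := by
    rw [abs_mul]
    calc (|a| * |b|) ^ η ≤ (m * m) ^ η := by gcongr
      _ = m ^ (2 * η) := by
        rw [← pow_two, ← Real.rpow_natCast, ← Real.rpow_mul (by linarith)]; norm_num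
      _ ≤ m ^ ρ := Real.rpow_le_rpow_of_exponent_le hm1 h
  refine h1.trans ?_
  have ha0 : 0 ≤ |a| ^ ρ := by positivity
  have hb0 : 0 ≤ |b| ^ ρ := by positivity
  rcases max_choice 1 (max |a| |b|) with e | e
  · rw [hm, e, Real.one_rpow]; linarith
  · rcases max_choice |a| |b| with e' | e' <;> rw [hm, e, e'] <;> linarith

/-- C1 bounds absolute moments of an order above `1` of all products of two coordinates. -/
theorem CondC1.exists_moment_bound [IsProbabilityMeasure P] {κ : Fin T → Fin K → Fin q}
    (hκ : Function.Surjective fun tk : Fin T × Fin K => κ tk.1 tk.2) {D : ℕ → S → Obs q p T}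
    (hD : ∀ i, Measurable (D i)) (h : CondC1 κ P D) :
    ∃ η : ℝ, 1 < η ∧ η ≤ 2 ∧ ∃ M : ℝ, ∀ i c d,
      Integrable (fun s => |coord (D i s) c * coord (D i s) d| ^ η) P ∧
      ∫ s, |coord (D i s) c * coord (D i s) d| ^ η ∂P ≤ M := by
  obtain ⟨ε, hε, M, hy, hx⟩ := h
  have hmeas : ∀ i c, Measurable fun s => coord (D i s) c := fun i c =>
    (measurable_coord c).comp (hD i)
  have hc : ∀ i c, Integrable (fun s => |coord (D i s) c| ^ (2 + ε)) P ∧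
      ∫ s, |coord (D i s) c| ^ (2 + ε) ∂P ≤ M + 1 := by
    intro i c
    rcases c with _ | k | r
    · simp [coord]
    · obtain ⟨⟨t, k'⟩, rfl⟩ := hκ k
      have := integrable_abs_rpow_of_lintegral_lt (hmeas i (some (Sum.inl (κ t k'))))
        (by linarith) (hx i t k')
      exact ⟨this.1, by linarith [this.2]⟩
    · have := integrable_abs_rpow_of_lintegral_lt (hmeas i (some (Sum.inr r)))
        (by linarith) (hy i r)
      exact ⟨this.1, by linarith [this.2]⟩
  -- order `1 + ε / 2` is available since `|a b| ≤ (max |a| |b|) ^ 2`; the strong law needs at most `2`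
  have hη : 0 < min (ε / 2) 1 := by positivity
  refine ⟨1 + min (ε / 2) 1, by linarith, by linarith [min_le_right (ε / 2) 1],
    1 + (M + 1) + (M + 1), fun i c d => ?_⟩
  have hpt : ∀ s, |coord (D i s) c * coord (D i s) d| ^ (1 + min (ε / 2) 1) ≤
      1 + |coord (D i s) c| ^ (2 + ε) + |coord (D i s) d| ^ (2 + ε) := fun s =>
    abs_mul_rpow_le (by linarith) (by linarith [min_le_left (ε / 2) 1])
  have hI1 : Integrable (fun s => 1 + |coord (D i s) c| ^ (2 + ε)) P :=
    (integrable_const _).add (hc i c).1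
  have hI := hI1.add (hc i d).1
  have hprod : Integrable
      (fun s => |coord (D i s) c * coord (D i s) d| ^ (1 + min (ε / 2) 1)) P := by
    refine hI.mono' ?_ (Eventually.of_forall fun s => ?_)
    · exact (((hmeas i c).mul (hmeas i d)).abs.pow_const _).aestronglyMeasurable
    · rw [Real.norm_of_nonneg (by positivity)]; exact hpt s
  refine ⟨hprod, (integral_mono hprod hI hpt).trans ?_⟩
  rw [integral_add' hI1 (hc i d).1, integral_add (integrable_const _) (hc i c).1]
  simp only [integral_const, probReal_univ, smul_eq_mul, one_mul]
  linarith [(hc i c).2, (hc i d).2]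

/-- The coordinates of an observation are square integrable. -/
theorem CondC1.memLp_coord [IsProbabilityMeasure P] {κ : Fin T → Fin K → Fin q}
    (hκ : Function.Surjective fun tk : Fin T × Fin K => κ tk.1 tk.2) {D : ℕ → S → Obs q p T}
    (hD : ∀ i, Measurable (D i)) (h : CondC1 κ P D) (i : ℕ) (c : Option (Fin q ⊕ Fin (p + T))) :
    MemLp (fun s => coord (D i s) c) 2 P := by
  obtain ⟨η, hη1, -, M, hM⟩ := CondC1.exists_moment_bound hκ hD h
  have hm : Measurable fun s => coord (D i s) c := (measurable_coord c).comp (hD i)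
  rw [memLp_two_iff_integrable_sq hm.aestronglyMeasurable]
  refine ((integrable_const (1 : ℝ)).add (hM i c c).1).mono'
    (hm.pow_const 2).aestronglyMeasurable (Eventually.of_forall fun s => ?_)
  rw [Pi.add_apply, pow_two, Real.norm_eq_abs]
  set a := |coord (D i s) c * coord (D i s) c|
  have ha : 0 ≤ a ^ η := by positivity
  rcases le_total a 1 with h1 | h1
  · linarith
  · linarith [Real.self_le_rpow_of_one_le h1 hη1.le]

end Moments

/-! ### The expected score of one observation -/

section SingleObservation

variable {q p K T : ℕ} {S : Type*} [MeasurableSpace S] {P : Measure S} {Z : S → Obs q p T}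

theorem memLp_zVec (hL : ∀ c, MemLp (fun s => coord (Z s) c) 2 P) (a : Fin q ⊕ Fin p) :
    MemLp (fun s => zVec (Z s) a) 2 P := by
  rcases a with k | j
  · exact hL (some (Sum.inl k))
  · exact hL (some (Sum.inr (Fin.castAdd T j.rev)))

theorem memLp_wMat (hL : ∀ c, MemLp (fun s => coord (Z s) c) 2 P) (κ : Fin T → Fin K → Fin q)
    (t : Fin T) (g : GammaIdx q p K) : MemLp (fun s => wMat κ (Z s) t g) 2 P := by
  obtain ⟨c, hc⟩ := exists_coord_eq_augReg (p := p) κ t (some g)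
  refine (hL c).congr_norm ?_ (Eventually.of_forall fun s => ?_)
  · exact (hL c).aestronglyMeasurable.congr (Eventually.of_forall fun s => (hc (Z s)).symm)
  · rw [← hc]; rfl

theorem memLp_modelErr (hL : ∀ c, MemLp (fun s => coord (Z s) c) 2 P) (κ : Fin T → Fin K → Fin q)
    (δ : Fin p → ℝ) (β : Fin K → ℝ) (t : Fin T) :
    MemLp (fun s => modelErr κ δ β (Z s) t) 2 P :=
  ((hL (some (Sum.inr (Fin.natAdd p t)))).sub
    (memLp_finsetSum _ fun j _ => (memLp_wMat hL κ t (Sum.inl (Sum.inl j))).const_mul (δ j))).sub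
    (memLp_finsetSum _ fun k _ => (memLp_wMat hL κ t (Sum.inl (Sum.inr k))).const_mul (β k))

theorem memLp_projErr [IsProbabilityMeasure P]
    (hL : ∀ c, MemLp (fun s => coord (Z s) c) 2 P) (κ : Fin T → Fin K → Fin q)
    (δ : Fin p → ℝ) (β : Fin K → ℝ) (μ : ℝ) (θ : Fin q ⊕ Fin p → ℝ) (t : Fin T) :
    MemLp (fun s => projErr κ δ β μ θ (Z s) t) 2 P :=
  ((memLp_modelErr hL κ δ β t).sub (memLp_const μ)).sub
    (memLp_finsetSum _ fun a _ => (memLp_zVec hL a).mul_const (θ a))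

theorem resid_mkGamma (κ : Fin T → Fin K → Fin q) (δ : Fin p → ℝ) (β : Fin K → ℝ) (μ : ℝ)
    (θ : Fin q ⊕ Fin p → ℝ) (o : Obs q p T) (t : Fin T) :
    resid κ o (mkGamma δ β μ θ) t = projErr κ δ β μ θ o t := by
  simp only [resid, projErr, modelErr, wMat, mkGamma, Matrix.mulVec, dotProduct, Pi.sub_apply,
    Matrix.of_apply, Fintype.sum_sum_type, Sum.elim_inl, Sum.elim_inr, Finset.univ_unique,
    Finset.sum_singleton, one_mul, mul_comm (δ _), mul_comm (β _)]
  ring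

/-- The projection error has mean zero and is uncorrelated with `z`: the normal equations of the
linear projection. -/
theorem integral_projErr_eq_zero [IsProbabilityMeasure P]
    (hL : ∀ c, MemLp (fun s => coord (Z s) c) 2 P)
    {κ : Fin T → Fin K → Fin q} {δ : Fin p → ℝ} {β : Fin K → ℝ}
    {Ξ : Matrix (Fin q ⊕ Fin p) (Fin q ⊕ Fin p) ℝ} {μz : Fin q ⊕ Fin p → ℝ} {μe : ℝ}
    {ϱ : Fin q ⊕ Fin p → ℝ} (hΞ : Ξ.PosDef)
    (hcov : ∀ a b, cov[fun s => zVec (Z s) a, fun s => zVec (Z s) b; P] = Ξ a b)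
    (hz : ∀ a, ∫ s, zVec (Z s) a ∂P = μz a)
    (he : ∀ t, ∫ s, modelErr κ δ β (Z s) t ∂P = μe)
    (hze : ∀ t a, ∫ s, zVec (Z s) a * modelErr κ δ β (Z s) t ∂P = ϱ a) (t : Fin T) :
    ∫ s, projErr κ δ β (mu0 Ξ μz μe ϱ) (theta0 Ξ μz μe ϱ) (Z s) t ∂P = 0 ∧
    ∀ a, ∫ s, zVec (Z s) a *
      projErr κ δ β (mu0 Ξ μz μe ϱ) (theta0 Ξ μz μe ϱ) (Z s) t ∂P = 0 := by
  set θ := theta0 Ξ μz μe ϱ with hθ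
  have hmu : mu0 Ξ μz μe ϱ = μe - μz ⬝ᵥ θ := rfl
  set μ := mu0 Ξ μz μe ϱ
  have hzI : ∀ a, Integrable (fun s => zVec (Z s) a) P := fun a =>
    (memLp_zVec hL a).integrable (by norm_num)
  have heI : Integrable (fun s => modelErr κ δ β (Z s) t) P :=
    (memLp_modelErr hL κ δ β t).integrable (by norm_num)
  have hzzI : ∀ a b, Integrable (fun s => zVec (Z s) a * zVec (Z s) b) P := fun a b =>
    (memLp_zVec hL a).integrable_mul (memLp_zVec hL b)
  have hzeI : ∀ a, Integrable (fun s => zVec (Z s) a * modelErr κ δ β (Z s) t) P := fun a =>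
    (memLp_zVec hL a).integrable_mul (memLp_modelErr hL κ δ β t)
  have hzz : ∀ a b, ∫ s, zVec (Z s) a * zVec (Z s) b ∂P = Ξ a b + μz a * μz b := fun a b => by
    have := hcov a b
    rw [covariance_eq_sub (memLp_zVec hL a) (memLp_zVec hL b), hz, hz] at this
    simp only [Pi.mul_apply] at this
    linarith
  have hΞθ : ∀ a, ∑ b, Ξ a b * θ b = ϱ a - μe * μz a := fun a => by
    have : Ξ *ᵥ θ = ϱ - μe • μz := by
      rw [hθ, theta0, Matrix.mulVec_mulVec, Matrix.mul_nonsing_inv _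
        (isUnit_iff_ne_zero.2 hΞ.det_pos.ne'), Matrix.one_mulVec]
    simpa [Matrix.mulVec, dotProduct] using congrFun this a
  constructor
  · simp only [projErr, dotProduct]
    have hI1 : Integrable (fun s => modelErr κ δ β (Z s) t - μ) P := heI.sub (integrable_const _)
    rw [integral_sub hI1 (integrable_finsetSum _ fun b _ => (hzI b).mul_const (θ b)),
      integral_sub heI (integrable_const _),
      integral_finsetSum _ fun b _ => (hzI b).mul_const (θ b)]
    simp only [integral_mul_const, hz, he, hmu, dotProduct, integral_const, probReal_univ,
      one_smul]
    ring
  · intro a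
    have hexp : ∀ s, zVec (Z s) a * projErr κ δ β μ θ (Z s) t =
        zVec (Z s) a * modelErr κ δ β (Z s) t - zVec (Z s) a * μ -
          ∑ b, zVec (Z s) a * zVec (Z s) b * θ b := fun s => by
      simp only [projErr, dotProduct, mul_sub, Finset.mul_sum, mul_assoc]
    simp only [hexp]
    have hI1 : Integrable
        (fun s => zVec (Z s) a * modelErr κ δ β (Z s) t - zVec (Z s) a * μ) P :=
      (hzeI a).sub ((hzI a).mul_const _)
    rw [integral_sub hI1 (integrable_finsetSum _ fun b _ => (hzzI a b).mul_const (θ b)),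
      integral_sub (hzeI a) ((hzI a).mul_const _),
      integral_finsetSum _ fun b _ => (hzzI a b).mul_const (θ b)]
    simp only [integral_mul_const, hzz, hz, hze]
    simp only [add_mul, Finset.sum_add_distrib, hΞθ, hmu,
      dotProduct, mul_assoc, ← Finset.mul_sum]
    ring

/-- The expected score of one observation vanishes at the true parameter. For a regression
coefficient this says that `η = Ω₀⁻¹ u` satisfies `E (η_t W_t) = 0`: by recursion on the date, `η_t`
is uncorrelated with every `y` dated before `t`, since it is uncorrelated with `z` and with
`u_{t'}` for `t' ≠ t`. -/
theorem integral_partialDeriv_logLik_eq_zero [IsProbabilityMeasure P]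
    (hL : ∀ c, MemLp (fun s => coord (Z s) c) 2 P)
    {κ : Fin T → Fin K → Fin q} {δ : Fin p → ℝ} {β : Fin K → ℝ} {μ : ℝ}
    {θ : Fin q ⊕ Fin p → ℝ} {Ω : Matrix (Fin T) (Fin T) ℝ} (hΩ : Ω.PosDef)
    (hu : ∀ t, ∫ s, projErr κ δ β μ θ (Z s) t ∂P = 0)
    (hzu : ∀ t a, ∫ s, zVec (Z s) a * projErr κ δ β μ θ (Z s) t ∂P = 0)
    (huu : ∀ r t, ∫ s, projErr κ δ β μ θ (Z s) r * projErr κ δ β μ θ (Z s) t ∂P = Ω r t)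
    (a : PsiIdx q p K T) :
    ∫ s, partialDeriv (logLik κ (Z s)) a (mkPsi (mkGamma δ β μ θ) Ω) ∂P = 0 := by
  set ψ : PsiIdx q p K T → ℝ := mkPsi (mkGamma δ β μ θ) Ω with hψ
  have hdet : IsUnit Ω.det := isUnit_iff_ne_zero.2 hΩ.det_pos.ne'
  have hω : omegaOf ψ = Ω := ofVech_vech (Matrix.isHermitian_iff_isSymm.1 hΩ.1)
  have hγ : gammaOf ψ = mkGamma δ β μ θ := rfl
  have hmem : ψ ∈ paramSpace q p K T := by
    change (omegaOf ψ).PosDef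
    rw [hω]; exact hΩ
  set u : S → Fin T → ℝ := fun s t => projErr κ δ β μ θ (Z s) t with hudef
  have hres : ∀ s, resid κ (Z s) (gammaOf ψ) = u s := fun s => by
    funext t; rw [hγ, resid_mkGamma]
  have huL : ∀ t, MemLp (fun s => u s t) 2 P := memLp_projErr hL κ δ β μ θ
  have huuI : ∀ r t, Integrable (fun s => u s r * u s t) P := fun r t =>
    (huL r).integrable_mul (huL t)
  rcases a with g | a
  · simp only [partialDeriv_logLik_inl κ _ hmem, hres, hω]
    set η : S → Fin T → ℝ := fun s => Ω⁻¹ *ᵥ u s with hη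
    have hηL : ∀ t, MemLp (fun s => η s t) 2 P := fun t =>
      memLp_finsetSum Finset.univ fun r _ => (huL r).const_mul (Ω⁻¹ t r)
    -- moments of `η` are obtained from those of `u`
    have hEη : ∀ (t : Fin T) (f : S → ℝ), MemLp f 2 P →
        ∫ s, f s * η s t ∂P = ∑ r, Ω⁻¹ t r * ∫ s, f s * u s r ∂P := fun t f hf => by
      have : ∀ s, f s * η s t = ∑ r, Ω⁻¹ t r * (f s * u s r) := fun s => by
        simp only [hη, Matrix.mulVec, dotProduct, Finset.mul_sum]
        exact Finset.sum_congr rfl fun r _ => by ring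
      have hfI : ∀ r, Integrable (fun s => Ω⁻¹ t r * (f s * u s r)) P := fun r =>
        (hf.integrable_mul (huL r)).const_mul _
      simp only [this]
      rw [integral_finsetSum _ fun r _ => hfI r]
      simp only [integral_const_mul]
    have hη1 : ∀ t, ∫ s, η s t ∂P = 0 := fun t => by
      have := hEη t (fun _ => 1) (memLp_const 1)
      simp only [one_mul] at this
      rw [this]
      exact Finset.sum_eq_zero fun r _ => by rw [hu, mul_zero]
    have hηz : ∀ t a, ∫ s, zVec (Z s) a * η s t ∂P = 0 := fun t a => by
      rw [hEη t _ (memLp_zVec hL a)]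
      exact Finset.sum_eq_zero fun r _ => by rw [hzu, mul_zero]
    have hηu : ∀ t r, r ≠ t → ∫ s, u s r * η s t ∂P = 0 := fun t r hrt => by
      rw [hEη t _ (huL r)]
      have : ∀ r', ∫ s, u s r * u s r' ∂P = Ω r' r := fun r' => by
        rw [← huu]; exact integral_congr_ae (Eventually.of_forall fun s => mul_comm _ _)
      simp only [this]
      have h1 := congrFun (congrFun (Matrix.nonsing_inv_mul Ω hdet) t) r
      rwa [Matrix.mul_apply, Matrix.one_apply_ne hrt.symm] at h1
    have hηy : ∀ (r : ℕ) (hr : r < p + T) (t : Fin T), r < p + t →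
        ∫ s, (Z s).2 ⟨r, hr⟩ * η s t ∂P = 0 := by
      intro r
      induction r using Nat.strong_induction_on with
      | _ r ih =>
        intro hr t hrt
        by_cases hrp : r < p
        · have := hηz t (Sum.inr (Fin.rev ⟨r, hrp⟩))
          simpa [zVec, Fin.castAdd] using this
        · -- the model equation at the date of position `r`
          let t' : Fin T := ⟨r - p, by omega⟩
          have hpos : (⟨r, hr⟩ : Fin (p + T)) = Fin.natAdd p t' := by
            ext; simp [t']; omega
          have heq : ∀ s, (Z s).2 ⟨r, hr⟩ * η s t = u s t' * η s t + μ * η s t +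
              ∑ a, θ a * (zVec (Z s) a * η s t) + ∑ j, δ j * (yLag (Z s) t' j * η s t) +
              ∑ k, β k * (xReg κ (Z s) t' k * η s t) := fun s => by
            have : (Z s).2 ⟨r, hr⟩ = u s t' + μ + ∑ a, θ a * zVec (Z s) a +
                ∑ j, δ j * yLag (Z s) t' j + ∑ k, β k * xReg κ (Z s) t' k := by
              simp only [hudef, projErr, modelErr, yCur, hpos, dotProduct, mul_comm (θ _)]
              ring
            rw [this]
            simp only [add_mul, Finset.sum_mul, mul_assoc]
          have hI : ∀ f : S → ℝ, MemLp f 2 P → Integrable (fun s => f s * η s t) P :=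
            fun f hf => hf.integrable_mul (hηL t)
          have hI1 := hI _ (huL t')
          have hI2 : Integrable (fun s => μ * η s t) P :=
            ((hηL t).integrable (by norm_num)).const_mul μ
          have hI3 : Integrable (fun s => ∑ a, θ a * (zVec (Z s) a * η s t)) P :=
            integrable_finsetSum _ fun a _ => (hI _ (memLp_zVec hL a)).const_mul _
          have hlag : ∀ j, Integrable (fun s => yLag (Z s) t' j * η s t) P := fun j =>
            hI _ (memLp_wMat hL κ t' (Sum.inl (Sum.inl j)))
          have hreg : ∀ k, Integrable (fun s => xReg κ (Z s) t' k * η s t) P := fun k =>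
            hI _ (memLp_wMat hL κ t' (Sum.inl (Sum.inr k)))
          have hI4 : Integrable (fun s => ∑ j, δ j * (yLag (Z s) t' j * η s t)) P :=
            integrable_finsetSum _ fun j _ => (hlag j).const_mul _
          have hI5 : Integrable (fun s => ∑ k, β k * (xReg κ (Z s) t' k * η s t)) P :=
            integrable_finsetSum _ fun k _ => (hreg k).const_mul _
          have h1 := hηu t t' fun h => by
            have := congrArg Fin.val h
            simp only [t'] at this
            omega
          have h3 : ∫ s, ∑ a, θ a * (zVec (Z s) a * η s t) ∂P = 0 := by
            rw [integral_finsetSum _ fun a _ => (hI _ (memLp_zVec hL a)).const_mul (θ a)]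
            exact Finset.sum_eq_zero fun a _ => by rw [integral_const_mul, hηz, mul_zero]
          have h4 : ∫ s, ∑ j, δ j * (yLag (Z s) t' j * η s t) ∂P = 0 := by
            rw [integral_finsetSum _ fun j _ => (hlag j).const_mul (δ j)]
            refine Finset.sum_eq_zero fun j _ => ?_
            have := ih (p + t'.val - (j.val + 1)) (by simp only [t']; omega) (by omega) t
              (by simp only [t']; omega)
            rw [integral_const_mul]
            simp only [yLag, this, mul_zero]
          have h5 : ∫ s, ∑ k, β k * (xReg κ (Z s) t' k * η s t) ∂P = 0 := by
            rw [integral_finsetSum _ fun k _ => (hreg k).const_mul (β k)]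
            refine Finset.sum_eq_zero fun k _ => ?_
            have := hηz t (Sum.inl (κ t' k))
            simp only [zVec, Sum.elim_inl] at this
            rw [integral_const_mul]
            simp only [xReg, this, mul_zero]
          refine (integral_congr_ae (Eventually.of_forall heq)).trans
            ((integral_add' (((hI1.add hI2).add hI3).add hI4) hI5).trans ?_)
          rw [integral_add' ((hI1.add hI2).add hI3) hI4, integral_add' (hI1.add hI2) hI3,
            integral_add' hI1 hI2, integral_const_mul, hη1, h1, h3, h4, h5]
          simp
    have hηw : ∀ t, ∫ s, wMat κ (Z s) t g * η s t ∂P = 0 := fun t => by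
      rcases g with (j | k) | (_ | b)
      · exact hηy _ _ t (by omega)
      · exact hηz t (Sum.inl (κ t k))
      · simpa [wMat] using hη1 t
      · exact hηz t b
    have hwI : ∀ t, Integrable (fun s => wMat κ (Z s) t g * η s t) P := fun t =>
      (memLp_wMat hL κ t g).integrable_mul (hηL t)
    rw [integral_finsetSum _ fun t _ => hwI t]
    exact Finset.sum_eq_zero fun t _ => hηw t
  · simp only [partialDeriv_logLik_inr κ _ hmem, hres, hω]
    set B : Matrix (Fin T) (Fin T) ℝ := ofVech (Pi.single a 1)
    set C := Ω⁻¹ * B * Ω⁻¹ with hC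
    have hquad : ∀ s, u s ⬝ᵥ (C *ᵥ u s) = ∑ r, ∑ t, C r t * (u s t * u s r) := fun s => by
      simp only [dotProduct, Matrix.mulVec, Finset.mul_sum]
      exact Finset.sum_congr rfl fun r _ => Finset.sum_congr rfl fun t _ => by ring
    have hCI : ∀ r t, Integrable (fun s => C r t * (u s t * u s r)) P := fun r t =>
      (huuI t r).const_mul _
    have hCI' : ∀ r, Integrable (fun s => ∑ t, C r t * (u s t * u s r)) P := fun r =>
      integrable_finsetSum _ fun t _ => hCI r t
    have hI : Integrable (fun s => u s ⬝ᵥ (C *ᵥ u s)) P := by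
      simp only [hquad]
      exact integrable_finsetSum _ fun r _ => hCI' r
    have hE : ∫ s, u s ⬝ᵥ (C *ᵥ u s) ∂P = (Ω⁻¹ * B).trace := by
      simp only [hquad]
      rw [integral_finsetSum _ fun r _ => hCI' r]
      have : ∀ r, ∫ s, ∑ t, C r t * (u s t * u s r) ∂P = (C * Ω) r r := fun r => by
        rw [integral_finsetSum _ fun t _ => hCI r t, Matrix.mul_apply]
        exact Finset.sum_congr rfl fun t _ => by rw [integral_const_mul, huu]
      simp only [this]
      rw [hC, Matrix.nonsing_inv_mul_cancel_right _ _ hdet]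
      rfl
    rw [integral_add (integrable_const _) (hI.const_mul _), integral_const_mul (1 / 2 : ℝ), hE]
    simp

end SingleObservation

/-! ### Limits of the sample moments and consistency -/

section MomentLimits

variable {q p K T : ℕ} {S : Type*} [MeasurableSpace S] {P : Measure S}
  {D : ℕ → S → Obs q p T} {κ : Fin T → Fin K → Fin q} {δ : Fin p → ℝ} {β : Fin K → ℝ}
  {Ξ : Matrix (Fin q ⊕ Fin p) (Fin q ⊕ Fin p) ℝ} {μz : Fin q ⊕ Fin p → ℝ} {μe : ℝ}
  {ϱ : Fin q ⊕ Fin p → ℝ}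

theorem avgConverges_const (c : ℝ) : AvgConverges fun _ => c := by
  refine ⟨c, tendsto_const_nhds.congr' ?_⟩
  filter_upwards [eventually_gt_atTop 0] with N hN
  have : (N : ℝ) ≠ 0 := by positivity
  simp [this]

/-- Under C2 the mean of each coordinate is the same for all individuals; for `y_1, …, y_T` this
follows from the model equation by recursion on the date. -/
theorem exists_integral_coord_eq [IsProbabilityMeasure P]
    (hL : ∀ i c, MemLp (fun s => coord (D i s) c) 2 P)
    (hC2 : CondC2 κ P D δ β Ξ μz μe ϱ) (c : Option (Fin q ⊕ Fin (p + T))) :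
    ∃ e : ℝ, ∀ i, ∫ s, coord (D i s) c ∂P = e := by
  obtain ⟨-, -, hz, he, -⟩ := hC2
  have hy : ∀ (r : ℕ) (hr : r < p + T), ∃ e : ℝ, ∀ i, ∫ s, (D i s).2 ⟨r, hr⟩ ∂P = e := by
    intro r
    induction r using Nat.strong_induction_on with
    | _ r ih =>
      intro hr
      by_cases hrp : r < p
      · refine ⟨μz (Sum.inr (Fin.rev ⟨r, hrp⟩)), fun i => ?_⟩
        rw [← hz i]
        simp [zVec, Fin.castAdd]
      · let t : Fin T := ⟨r - p, by omega⟩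
        have hpos : (⟨r, hr⟩ : Fin (p + T)) = Fin.natAdd p t := by ext; simp [t]; omega
        have hlag : ∀ j : Fin p, ∃ e : ℝ, ∀ i, ∫ s, yLag (D i s) t j ∂P = e := fun j =>
          ih (p + t.val - (j.val + 1)) (by simp only [t]; omega) (by omega)
        choose e hlage using hlag
        refine ⟨μe + ∑ j, δ j * e j + ∑ k, β k * μz (Sum.inl (κ t k)), fun i => ?_⟩
        have heq : ∀ s, (D i s).2 ⟨r, hr⟩ = modelErr κ δ β (D i s) t +
            ∑ j, δ j * yLag (D i s) t j + ∑ k, β k * xReg κ (D i s) t k := fun s => by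
          rw [hpos, modelErr, yCur]; ring
        have hI1 : Integrable (fun s => modelErr κ δ β (D i s) t) P :=
          (memLp_modelErr (hL i) κ δ β t).integrable (by norm_num)
        have hI2 : ∀ j, Integrable (fun s => δ j * yLag (D i s) t j) P := fun j =>
          ((memLp_wMat (hL i) κ t (Sum.inl (Sum.inl j))).integrable (by norm_num)).const_mul (δ j)
        have hI3 : ∀ k, Integrable (fun s => β k * xReg κ (D i s) t k) P := fun k =>
          ((memLp_wMat (hL i) κ t (Sum.inl (Sum.inr k))).integrable (by norm_num)).const_mul (β k)
        have hI2' := integrable_finsetSum Finset.univ fun j _ => hI2 j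
        have hI3' := integrable_finsetSum Finset.univ fun k _ => hI3 k
        refine (integral_congr_ae (Eventually.of_forall heq)).trans
          ((integral_add' (hI1.add hI2') hI3').trans ?_)
        rw [integral_add' hI1 hI2', integral_finsetSum _ fun j _ => hI2 j,
          integral_finsetSum _ fun k _ => hI3 k, he]
        simp only [integral_const_mul, hlage]
        congr 1
        refine Finset.sum_congr rfl fun k _ => ?_
        rw [← hz i]
        rfl
  rcases c with _ | k | ⟨r, hr⟩
  · exact ⟨1, fun i => by simp [coord]⟩
  · exact ⟨μz (Sum.inl k), fun i => hz i (Sum.inl k)⟩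
  · exact hy r hr

theorem avgConverges_integral_coord_mul [IsProbabilityMeasure P]
    (hκ : Function.Surjective fun tk : Fin T × Fin K => κ tk.1 tk.2)
    (hL : ∀ i c, MemLp (fun s => coord (D i s) c) 2 P)
    (hC2 : CondC2 κ P D δ β Ξ μz μe ϱ) (hC4 : CondC4 κ P D)
    (c d : Option (Fin q ⊕ Fin (p + T))) :
    AvgConverges fun i => ∫ s, coord (D i s) c * coord (D i s) d ∂P := by
  obtain ⟨hyy, hyx, hxx⟩ := hC4
  have hone : ∀ d, AvgConverges fun i => ∫ s, coord (D i s) d ∂P := fun d => by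
    obtain ⟨e, he⟩ := exists_integral_coord_eq hL hC2 d
    simpa only [he] using avgConverges_const e
  rcases c with _ | k | r
  · simpa only [coord, one_mul] using hone d
  · obtain ⟨⟨t, k⟩, rfl⟩ := hκ k
    rcases d with _ | k' | r'
    · simpa only [coord, mul_one] using hone (some (Sum.inl (κ t k)))
    · obtain ⟨⟨t', k'⟩, rfl⟩ := hκ k'
      exact hxx t k t' k'
    · simpa only [coord, mul_comm, xReg] using hyx r' t k
  · rcases d with _ | k' | r'
    · simpa only [coord, mul_one] using hone (some (Sum.inr r))
    · obtain ⟨⟨t', k'⟩, rfl⟩ := hκ k'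
      exact hyx r t' k'
    · exact hyy r r'

theorem measurable_augMoment (j : MomIdx q p K T) :
    Measurable fun o : Obs q p T => augMoment κ o j := by
  obtain ⟨c, d, h⟩ := exists_coord_mul_eq_augMoment (p := p) κ j
  simp only [h]
  exact (measurable_coord c).mul (measurable_coord d)

theorem integrable_augMoment (hL : ∀ i c, MemLp (fun s => coord (D i s) c) 2 P) (i : ℕ)
    (j : MomIdx q p K T) : Integrable (fun s => augMoment κ (D i s) j) P := by
  obtain ⟨c, d, h⟩ := exists_coord_mul_eq_augMoment (p := p) κ j
  simp only [h]
  exact (hL i c).integrable_mul (hL i d)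

theorem integrable_avgMoment (hL : ∀ i c, MemLp (fun s => coord (D i s) c) 2 P) (N : ℕ)
    (j : MomIdx q p K T) : Integrable (fun s => avgMoment κ (sample D N s) j) P :=
  (integrable_finsetSum Finset.univ fun (i : Fin N) _ =>
    integrable_augMoment hL i j).const_mul (N : ℝ)⁻¹

theorem integral_avgMoment (hL : ∀ i c, MemLp (fun s => coord (D i s) c) 2 P) (N : ℕ)
    (j : MomIdx q p K T) : ∫ s, avgMoment κ (sample D N s) j ∂P =
      (N : ℝ)⁻¹ * ∑ i ∈ Finset.range N, ∫ s, augMoment κ (D i s) j ∂P := by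
  simp only [avgMoment, sample]
  rw [integral_const_mul, integral_finsetSum _ fun i _ => integrable_augMoment hL _ j,
    Finset.sum_range]

/-- Strong law for the sample moments. -/
theorem ae_tendsto_avgMoment [IsProbabilityMeasure P]
    (hκ : Function.Surjective fun tk : Fin T × Fin K => κ tk.1 tk.2)
    (hD : ∀ i, Measurable (D i)) (hC1 : CondC1 κ P D) (hC5 : iIndepFun D P)
    {m : MomIdx q p K T → ℝ} (hm : ∀ j, Tendsto
      (fun N : ℕ => (N : ℝ)⁻¹ * ∑ i ∈ Finset.range N, ∫ s, augMoment κ (D i s) j ∂P)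
      atTop (𝓝 (m j))) :
    ∀ᵐ s ∂P, Tendsto (fun N => avgMoment κ (sample D N s)) atTop (𝓝 m) := by
  obtain ⟨η, hη1, hη2, M, hM⟩ := CondC1.exists_moment_bound hκ hD hC1
  have hlaw : ∀ j : MomIdx q p K T, ∀ᵐ s ∂P, Tendsto (fun N : ℕ => (N : ℝ)⁻¹ *
      ∑ i ∈ Finset.range N, (augMoment κ (D i s) j - ∫ v, augMoment κ (D i v) j ∂P))
      atTop (𝓝 0) := fun j => by
    obtain ⟨c, d, h⟩ := exists_coord_mul_eq_augMoment (p := p) κ j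
    refine ae_tendsto_average_centred (X := fun i s => augMoment κ (D i s) j)
      (fun i => (measurable_augMoment j).comp (hD i))
      (hC5.comp (fun _ o => augMoment κ o j) fun _ => measurable_augMoment j) hη1 hη2
      (M := M) (fun i => ?_) fun i => ?_
    · simpa only [h] using (hM i c d).1
    · simpa only [h] using (hM i c d).2
  filter_upwards [ae_all_iff.2 hlaw] with s hs
  refine tendsto_pi_nhds.2 fun j => ?_
  have := (hs j).add (hm j)
  rw [zero_add] at this
  refine this.congr fun N => ?_
  rw [← mul_add, ← Finset.sum_add_distrib, avgMoment, Finset.sum_range]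
  simp [sample]

/-- The score of the sample has mean zero at the true parameter. -/
theorem sum_partialDeriv_momCoef_mul_eq_zero {ψ₀ : PsiIdx q p K T → ℝ}
    (hψ₀ : ψ₀ ∈ paramSpace q p K T) (hL : ∀ i c, MemLp (fun s => coord (D i s) c) 2 P)
    {a : PsiIdx q p K T} (hscore : ∀ i, ∫ s, partialDeriv (logLik κ (D i s)) a ψ₀ ∂P = 0)
    (N : ℕ) :
    ∑ j, partialDeriv (momCoef j) a ψ₀ *
      ((N : ℝ)⁻¹ * ∑ i ∈ Finset.range N, ∫ s, augMoment κ (D i s) j ∂P) = 0 := by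
  have h1 : ∀ i, ∑ j, partialDeriv (momCoef j) a ψ₀ * ∫ s, augMoment κ (D i s) j ∂P = 0 := by
    intro i
    rw [← hscore i]
    have : ∀ o : Obs q p T, partialDeriv (logLik κ o) a ψ₀ =
        ∑ j, partialDeriv (momCoef j) a ψ₀ * augMoment κ o j := fun o => by
      rw [funext (logLik_eq_critFn κ o)]
      exact partialDeriv_critFn hψ₀ _ a
    simp only [this]
    rw [integral_finsetSum _ fun j _ => (integrable_augMoment hL i j).const_mul _]
    simp only [integral_const_mul]
  have h2 : ∑ j, partialDeriv (momCoef j) a ψ₀ *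
      ((N : ℝ)⁻¹ * ∑ i ∈ Finset.range N, ∫ s, augMoment κ (D i s) j ∂P) =
      (N : ℝ)⁻¹ * ∑ i ∈ Finset.range N,
        ∑ j, partialDeriv (momCoef j) a ψ₀ * ∫ s, augMoment κ (D i s) j ∂P := by
    rw [Finset.sum_comm, Finset.mul_sum]
    refine Finset.sum_congr rfl fun j _ => ?_
    rw [← Finset.mul_sum]
    ring
  rw [h2, Finset.sum_eq_zero fun i _ => h1 i, mul_zero]

/-- Measurable maximizers over a compact set on which `ψ₀` is the unique maximizer of the limiting
criterion exist and are consistent. -/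
theorem exists_measurable_maximizer_tendsto {C : Set (PsiIdx q p K T → ℝ)} (hC : IsCompact C)
    (hCΨ : C ⊆ paramSpace q p K T) {ψ₀ : PsiIdx q p K T → ℝ} (hψ₀ : ψ₀ ∈ C)
    {m : MomIdx q p K T → ℝ} (hmax : ∀ ψ ∈ C, ψ ≠ ψ₀ → critFn m ψ < critFn m ψ₀)
    (hlim : ∀ᵐ s ∂P, Tendsto (fun N => avgMoment κ (sample D N s)) atTop (𝓝 m)) :
    ∃ ψhat : (N : ℕ) → (Fin N → Obs q p T) → (PsiIdx q p K T → ℝ),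
      (∀ N, Measurable (ψhat N)) ∧
      (∀ N w, ψhat N w ∈ C ∧ IsMaxOn (avgLogLik κ w) C (ψhat N w)) ∧
      ∀ᵐ s ∂P, Tendsto (fun N => ψhat N (sample D N s)) atTop (𝓝 ψ₀) := by
  have : CompactSpace C := isCompact_iff_compactSpace.1 hC
  have : Nonempty C := ⟨⟨ψ₀, hψ₀⟩⟩
  let F : C × (MomIdx q p K T → ℝ) → ℝ := fun z => critFn z.2 z.1
  have hF : Continuous F := by
    refine continuous_finsetSum _ fun j _ => Continuous.mul ?_ (by fun_prop)
    have : Continuous fun ψ : C => momCoef j (ψ : PsiIdx q p K T → ℝ) :=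
      continuous_iff_continuousAt.2 fun ψ =>
        ((contDiffAt_momCoef (k := 0) (hCΨ ψ.2) j).continuousAt).comp
          continuous_subtype_val.continuousAt
    exact this.comp continuous_fst
  obtain ⟨f, hfm, hf⟩ := exists_measurable_isMaxOn hF
  refine ⟨fun N w => f (avgMoment κ w), fun N => ?_, fun N w => ⟨(f _).2, fun ψ hψ => ?_⟩, ?_⟩
  · refine measurable_subtype_coe.comp (hfm.comp (measurable_pi_lambda _ fun j => ?_))
    exact (Finset.measurable_fun_sum _ fun i _ =>
      (measurable_augMoment j).comp (measurable_pi_apply i)).const_mul _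
  · rw [avgLogLik_eq_critFn]
    exact hf (avgMoment κ w) ⟨ψ, hψ⟩
  · filter_upwards [hlim] with s hs
    have := tendsto_of_isMaxOn_of_unique hF (x₀ := ⟨ψ₀, hψ₀⟩) (m₀ := m) (fun x hx => ?_) hs
      fun N => hf _
    · exact (continuous_subtype_val.tendsto _).comp this
    · by_contra hne
      exact absurd (hmax x x.2 fun h => hne (Subtype.ext h)) (not_lt.2 hx)

end MomentLimits

/-! ### Score, Hessian and consistency -/

theorem theorem1 {q p K T : ℕ}
    -- which of the `q` distinct elements the regressor `x_{tk}` is; each of them occurs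
    (κ : Fin T → Fin K → Fin q)
    (hκ : Function.Surjective fun tk : Fin T × Fin K => κ tk.1 tk.2)
    {S : Type*} [MeasurableSpace S] (P : Measure S) [IsProbabilityMeasure P]
    (D : ℕ → S → Obs q p T) (hD : ∀ i, Measurable (D i))
    (δ₀ : Fin p → ℝ) (β₀ : Fin K → ℝ)
    (Ξ : Matrix (Fin q ⊕ Fin p) (Fin q ⊕ Fin p) ℝ) (μz : Fin q ⊕ Fin p → ℝ) (μe : ℝ)
    (ϱ : Fin q ⊕ Fin p → ℝ) (Ω₀ : Matrix (Fin T) (Fin T) ℝ)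
    (γ₀ : GammaIdx q p K → ℝ)
    (hγ₀ : γ₀ = mkGamma δ₀ β₀ (mu0 Ξ μz μe ϱ) (theta0 Ξ μz μe ϱ))
    (ψ₀ : PsiIdx q p K T → ℝ) (hψ₀ : ψ₀ = mkPsi γ₀ Ω₀)
    (hC1 : CondC1 κ P D)
    (hC2 : CondC2 κ P D δ₀ β₀ Ξ μz μe ϱ)
    (hC3 : CondC3 κ P D δ₀ β₀ (mu0 Ξ μz μe ϱ) (theta0 Ξ μz μe ϱ) Ω₀)
    (hC4 : CondC4 κ P D)
    (hC5 : iIndepFun D P) :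
    -- the score and the Hessian are classical derivatives on `Ψ`
    (∀ (N : ℕ) (w : Fin N → Obs q p T), ∀ ψ ∈ paramSpace q p K T,
      ContDiffAt ℝ 2 (avgLogLik κ w) ψ) ∧
    -- the expected score vanishes at `ψ₀`
    (∀ (N : ℕ) (a : PsiIdx q p K T),
      Integrable (fun s => partialDeriv (avgLogLik κ (sample D N s)) a ψ₀) P ∧
      ∫ s, partialDeriv (avgLogLik κ (sample D N s)) a ψ₀ ∂P = 0) ∧
    -- the limit of the expected Hessian exists, and the consistency claim
    ∃ H : (PsiIdx q p K T → ℝ) → Matrix (PsiIdx q p K T) (PsiIdx q p K T) ℝ,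
      (∀ ψ ∈ paramSpace q p K T,
        (∀ (N : ℕ) (a b : PsiIdx q p K T),
          Integrable (fun s => hessianMat (avgLogLik κ (sample D N s)) ψ a b) P) ∧
        Tendsto
          (fun N : ℕ => Matrix.of fun a b =>
            ∫ s, hessianMat (avgLogLik κ (sample D N s)) ψ a b ∂P)
          atTop (𝓝 (H ψ))) ∧
      ((-(H ψ₀)).PosDef →
        ∃ C : Set (PsiIdx q p K T → ℝ),
          IsCompact C ∧ C ⊆ paramSpace q p K T ∧ ψ₀ ∈ interior C ∧
          -- the estimator is a measurable function of the sample
          ∃ ψhat : (N : ℕ) → (Fin N → Obs q p T) → (PsiIdx q p K T → ℝ),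
            (∀ N, Measurable (ψhat N)) ∧
            (∀ N w, ψhat N w ∈ C ∧ IsMaxOn (avgLogLik κ w) C (ψhat N w)) ∧
            ∀ᵐ s ∂P, Tendsto (fun N => ψhat N (sample D N s)) atTop (𝓝 ψ₀)) := by
  have hL := fun i => CondC1.memLp_coord hκ hD hC1 i
  have hΩ₀ : Ω₀.PosDef := hC3.1
  have hmem : ψ₀ ∈ paramSpace q p K T := by
    change (omegaOf ψ₀).PosDef
    have hω : omegaOf ψ₀ = Ω₀ := by
      rw [hψ₀]
      exact ofVech_vech (Matrix.isHermitian_iff_isSymm.1 hΩ₀.1)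
    rwa [hω]
  have hscore : ∀ a i, ∫ s, partialDeriv (logLik κ (D i s)) a ψ₀ ∂P = 0 := fun a i => by
    have hproj := integral_projErr_eq_zero (hL i) hC2.1 (hC2.2.1 i) (hC2.2.2.1 i)
      (hC2.2.2.2.1 i) (hC2.2.2.2.2 i)
    rw [hψ₀, hγ₀]
    exact integral_partialDeriv_logLik_eq_zero (hL i) hΩ₀ (fun t => (hproj t).1)
      (fun t => (hproj t).2) (hC3.2 i) a
  have hlim : ∀ j : MomIdx q p K T, AvgConverges fun i => ∫ s, augMoment κ (D i s) j ∂P :=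
    fun j => by
      obtain ⟨c, d, h⟩ := exists_coord_mul_eq_augMoment (p := p) κ j
      simpa only [h] using avgConverges_integral_coord_mul hκ hL hC2 hC4 c d
  choose m hm using hlim
  have hgrad : ∀ a, partialDeriv (critFn m) a ψ₀ = 0 := fun a => by
    rw [partialDeriv_critFn hmem]
    -- both sides are the limit of the expected scores, which all vanish
    refine tendsto_nhds_unique
      (tendsto_finsetSum _ fun j _ => (hm j).const_mul (partialDeriv (momCoef j) a ψ₀)) ?_
    simp only [sum_partialDeriv_momCoef_mul_eq_zero hmem hL (hscore a)]
    exact tendsto_const_nhds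
  refine ⟨fun N w ψ hψ => ?_, fun N a => ⟨?_, ?_⟩, hessianMat (critFn m),
    fun ψ hψ => ⟨fun N a b => ?_, ?_⟩, fun hneg => ?_⟩
  · rw [avgLogLik_eq_critFn]
    exact contDiffAt_critFn hψ _
  · simp only [avgLogLik_eq_critFn, partialDeriv_critFn hmem]
    exact integrable_finsetSum _ fun j _ => (integrable_avgMoment hL N j).const_mul _
  · simp only [avgLogLik_eq_critFn, partialDeriv_critFn hmem]
    rw [integral_finsetSum _ fun j _ => (integrable_avgMoment hL N j).const_mul _]
    simp only [integral_const_mul, integral_avgMoment hL]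
    exact sum_partialDeriv_momCoef_mul_eq_zero hmem hL (hscore a) N
  · simp only [avgLogLik_eq_critFn, hessianMat_critFn hψ]
    exact integrable_finsetSum _ fun j _ => (integrable_avgMoment hL N j).const_mul _
  · refine tendsto_pi_nhds.2 fun a => tendsto_pi_nhds.2 fun b => ?_
    simp only [avgLogLik_eq_critFn, hessianMat_critFn hψ, Matrix.of_apply]
    refine (tendsto_finsetSum _ fun j _ => (hm j).const_mul (hessianMat (momCoef j) ψ a b)).congr
      fun N => ?_
    rw [integral_finsetSum _ fun j _ => (integrable_avgMoment hL N j).const_mul _]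
    simp only [integral_const_mul, integral_avgMoment hL]
  · have hopen := isOpen_paramSpace.mem_nhds hmem
    obtain ⟨r₁, hr₁, hlt⟩ := eventually_lt_of_hessian_negDef (f := critFn m)
      (by
        filter_upwards [hopen] with ψ hψ
        exact (contDiffAt_critFn (k := 1) hψ m).differentiableAt (by norm_num))
      (fun a => ((contDiffAt_critFn (k := 2) hmem m).partialDeriv (m := 1)
        (by norm_num) a).differentiableAt (by norm_num)) hgrad hneg
    obtain ⟨r₂, hr₂, hsub⟩ := Metric.nhds_basis_closedBall.mem_iff.1 hopen
    have hr : 0 < min r₁ r₂ := lt_min hr₁ hr₂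
    have hCΨ : Metric.closedBall ψ₀ (min r₁ r₂) ⊆ paramSpace q p K T :=
      (Metric.closedBall_subset_closedBall (min_le_right _ _)).trans hsub
    exact ⟨Metric.closedBall ψ₀ (min r₁ r₂), isCompact_closedBall _ _, hCΨ,
      mem_interior_iff_mem_nhds.2 (Metric.closedBall_mem_nhds _ hr),
      exists_measurable_maximizer_tendsto (isCompact_closedBall _ _) hCΨ
        (Metric.mem_closedBall_self hr.le)
        (fun ψ hψ hne => hlt ψ (Metric.closedBall_subset_closedBall (min_le_left _ _) hψ) hne)
        (ae_tendsto_avgMoment hκ hD hC1 hC5 hm)⟩
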